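/- **Conventions.** All structures are finite and all signatures relational. For a structure $\mathfrak A$ with domain $A$ let $A^{\le}=\{0,1,\dots,|A|\}$. Variables have a sort, element or number; element variables range over $A$ and number variables over $A^{\le}$. For a word $T$ over $\{\text{element},\text{number}\}$, $A^T$ is the product of the corresponding ranges; relation symbols and relation variables have such a word as type. $\mathsf{FP}+\mathsf{ord}$ is the two-sorted logic with first-order connectives and quantifiers, equality, the order $\le$ on numbers, counting, inflationary fixed points, and the following operator $\mathsf{ord}$. For a formula $\varphi(\vec p,\vec s,\vec t)$ with $\vec s,\vec t$ of the same type $T$ and $\vec p$ of type $P$, let $\langle\varphi\rangle_{\vec p.\vec s.\vec t}^{\mathfrak A}\le \mathrm{Sym}(A^T)$ be the group generated by all $\sigma\in\mathrm{Sym}(A^T)$ such that $\mathrm{graph}(\sigma)=\varphi(\mathfrak A,\vec a)$ for some $\vec a\in A^{P}$. A $k$-ary numerical relation $Q\subseteq (A^{\le})^k$ *encodes* $N\in\mathbb N$ if, for all $\vec\mu\in (A^{\le})^k$, $\vec\mu\in Q$ iff the bit of weight $2^{j}$, $j=\sum_{i=1}^{k}|A|^{k-i}\mu_i$, of the binary expansion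 of $N$ is $1$. Then $(\mathsf{ord}_{\vec p.\vec s.\vec t}\,\varphi)$ is the $2|T|$-ary numerical relation encoding $|\langle\varphi\rangle_{\vec p.\vec s.\vec t}^{\mathfrak A}|$. For $G\le\mathrm{Sym}(A^T)$, a formula $\varphi_m(R,\vec x,\vec y)$, with $R$ a relation variable of type $T\cdot T$ and $\vec x,\vec y$ of type $T'$, *defines the morphism* $m:G\to \mathrm{Sym}(A^{T'})$ on $\mathfrak A$ if $m$ is a group morphism and $\varphi_m(\mathfrak A,\mathrm{graph}(\sigma))=\mathrm{graph}(m(\sigma))$ for all $\sigma\in G$. **Lemma.** Let $\varphi_G(\vec p,\vec s,\vec t)$, with $\vec s,\vec t$ of type $T$, and $\varphi_m(R,\vec x,\vec y)$, with $R$ of type $T\cdot T$ and $\vec x,\vec y$ of type $T'$, be two $(\mathsf{FP}+\mathsf{ord})[\Sigma]$-formulae. There are $(\mathsf{FP}+\mathsf{ord})[\Sigma]$-formulae $\varphi_{\in}(R)$ and $\varphi_{\mathsf{ord}}(\vec\mu)$, where $\vec\mu$ consists of $2|T|$ number variables, such that, on every finite $\Sigma$-structure $\mathfrak A$ on which $\varphi_m$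 defines a morphism $m$ from $G:=\langle\varphi_G\rangle_{\vec p.\vec s.\vec t}^{\mathfrak A}$ to $\mathrm{Sym}(A^{T'})$: 1. $\varphi_{\mathsf{ord}}(\mathfrak A)$ is a $2|T|$-ary numerical relation that encodes $|\ker(m)|$, and $|\ker(m)|=|G|/|\mathrm{im}(m)|$; 2. for every $\tau\in\mathrm{Sym}(A^{T})$, $(\mathfrak A,\mathrm{graph}(\tau))\models\varphi_{\in}$ if and only if $\tau\in\ker(m)$. -/

import Mathlib

universe u w z

namespace FPOrd

/-- The two sorts of variables: domain elements and numbers. A type word is a `List Srt`. -/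
inductive Srt : Type
  | element : Srt
  | number : Srt

/-- A relational signature; every relation symbol has a type word. -/
structure Signature : Type (w + 1) where
  Rel : Type w
  type : Rel → List Srt

/-- The range of a variable of a given sort: `Dom A element` is (a copy of) `A`, and
`Dom A number` is (a copy of) `A^≤ = {0, 1, …, |A|}`. -/
inductive Dom (A : Type u) : Srt → Type u
  | element (a : A) : Dom A Srt.element
  | number (i : Fin (Nat.card A + 1)) : Dom A Srt.number

/-- The integer that a numerical element is. -/
def Dom.val {A : Type u} : Dom A Srt.number → ℕ
  | .number i => i.val

/-- The tuples with one entry in `F a` for each letter `a` of the word `l`: `∏ᵢ F (lᵢ)`. -/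
inductive HList {α : Type z} (F : α → Type u) : List α → Type (max u z)
  | nil : HList F []
  | cons {a : α} {l : List α} (x : F a) (xs : HList F l) : HList F (a :: l)

/-- `A^T`, the product of the ranges of the letters of the word `T`. -/
abbrev Tup (A : Type u) (T : List Srt) : Type u := HList (Dom A) T

/-- A (finite, once `A` is finite) structure over the signature `S` with domain `A`. -/
structure Str (S : Signature.{w}) (A : Type u) : Type (max u w) where
  rel : (R : S.Rel) → Tup A (S.type R) → Prop

/-- Positions in the list `l` that carry the label `a`: the variables of label `a` in a
context `l` (de Bruijn style). -/
inductive Idx {α : Type z} : List α → α → Type z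
  | zero {a : α} {l : List α} : Idx (a :: l) a
  | succ {a b : α} {l : List α} : Idx l a → Idx (b :: l) a

/-- The component of a tuple at a position. -/
def proj {α : Type z} {F : α → Type u} : {l : List α} → {a : α} → Idx l a → HList F l → F a
  | _, _, .zero, .cons x _ => x
  | _, _, .succ i, .cons _ xs => proj i xs

/-- Concatenation of tuples. -/
def append {α : Type z} {F : α → Type u} :
    {l l' : List α} → HList F l → HList F l' → HList F (l ++ l')
  | _, _, .nil, v => v
  | _, _, .cons x xs, v => .cons x (append xs v)

/-- The values of a tuple of variables under the assignment `v`. -/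
def values {α : Type z} {F : α → Type u} {Γ : List α} (v : HList F Γ) :
    {T : List α} → HList (Idx Γ) T → HList F T
  | _, .nil => .nil
  | _, .cons x xs => .cons (proj x v) (values v xs)

/-- The type word `number^k`. -/
abbrev numbers (k : ℕ) : List Srt := List.replicate k Srt.number

/-- Formulae of fixed-point logic with counting and the group order operator.
`Formula S Δ Γ` consists of the formulae over `S` whose free relation variables are listed, with
their type words, in `Δ`, and whose free first-order variables are listed, with their sorts,
in `Γ`. The newly bound variables of an operator are put in front of the context.
The connectives and quantifiers `∨`, `→`, `↔`, `∃` are the usual abbreviations. -/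
inductive Formula (S : Signature.{w}) : List (List Srt) → List Srt → Type w
  /-- `R(x₁, …, x_k)` for a relation symbol `R` -/
  | rel {Δ : List (List Srt)} {Γ : List Srt} (R : S.Rel)
      (x : HList (Idx Γ) (S.type R)) : Formula S Δ Γ
  /-- `X(x₁, …, x_k)` for a relation variable `X` -/
  | rvar {Δ : List (List Srt)} {Γ : List Srt} {T : List Srt} (X : Idx Δ T)
      (x : HList (Idx Γ) T) : Formula S Δ Γ
  /-- `x = y` -/
  | eq {Δ : List (List Srt)} {Γ : List Srt} {a : Srt} (x y : Idx Γ a) : Formula S Δ Γ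
  /-- `μ ≤ ν`, for numerical variables -/
  | le {Δ : List (List Srt)} {Γ : List Srt} (μ ν : Idx Γ Srt.number) : Formula S Δ Γ
  /-- negation -/
  | neg {Δ : List (List Srt)} {Γ : List Srt} (φ : Formula S Δ Γ) : Formula S Δ Γ
  /-- conjunction -/
  | and {Δ : List (List Srt)} {Γ : List Srt} (φ ψ : Formula S Δ Γ) : Formula S Δ Γ
  /-- universal quantification over a variable of sort `a` -/
  | all {Δ : List (List Srt)} {Γ : List Srt} (a : Srt) (φ : Formula S Δ (a :: Γ)) :
      Formula S Δ Γ
  /-- the counting atom `#x. φ = μ`, with `x` a domain variable -/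
  | count {Δ : List (List Srt)} {Γ : List Srt} (φ : Formula S Δ (Srt.element :: Γ))
      (μ : Idx Γ Srt.number) : Formula S Δ Γ
  /-- the inflationary fixed point `[ifp_{X, y} φ](x)`, with `X` and `y` of type `T` -/
  | ifp {Δ : List (List Srt)} {Γ : List Srt} (T : List Srt) (φ : Formula S (T :: Δ) (T ++ Γ))
      (x : HList (Idx Γ) T) : Formula S Δ Γ
  /-- the group order operator `(ord_{p.s.t} φ)(μ)`, with `p` of type `P`, and `s`, `t` of
  type `T` -/
  | ord {Δ : List (List Srt)} {Γ : List Srt} (P T : List Srt)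
      (φ : Formula S Δ (P ++ (T ++ (T ++ Γ))))
      (μ : HList (Idx Γ) (numbers (2 * T.length))) : Formula S Δ Γ

/-- The stages `X₀ = ∅`, `X_{n+1} = X_n ∪ F(X_n)` of the inflationary fixed point of `F`. -/
def stage {α : Type u} (F : (α → Prop) → α → Prop) : ℕ → α → Prop
  | 0 => fun _ => False
  | n + 1 => fun a => stage F n a ∨ F (stage F n) a

/-- The graph of `σ`, as a relation of type `T · T`. -/
def graph {A : Type u} {T : List Srt} (σ : Equiv.Perm (Tup A T)) (w : Tup A (T ++ T)) : Prop :=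
  ∃ a : Tup A T, w = append a (σ a)

/-- For a family `(Φ a)_a` of binary relations on `β`, the group generated by those permutations
of `β` whose graph is `Φ a` for some `a`. -/
def spanGroup {α β : Type u} (Φ : α → β → β → Prop) : Subgroup (Equiv.Perm β) :=
  Subgroup.closure {σ | ∃ a, ∀ b c, Φ a b c ↔ σ b = c}

/-- The number `∑_{i = 1}^k |A|^{k - i} μ_i` that is encoded by `(μ₁, …, μ_k)`. -/
noncomputable def index {A : Type u} : {k : ℕ} → Tup A (numbers k) → ℕ
  | 0, _ => 0
  | k + 1, .cons μ μs => Nat.card A ^ k * μ.val + index (k := k) μs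

/-- The numerical relation `Q` is the binary encoding of `N`: it holds at `μ` iff the bit of
weight `2 ^ index μ` of `N` is `1`. -/
def Encodes {A : Type u} {k : ℕ} (Q : Tup A (numbers k) → Prop) (N : ℕ) : Prop :=
  ∀ μ : Tup A (numbers k), Q μ ↔ N.testBit (index μ) = true

/-- Satisfaction, under an interpretation `X` of the free relation variables and an
assignment `v` of the free first-order variables. -/
def Formula.Holds {S : Signature.{w}} {A : Type u} (𝔄 : Str S A) :
    {Δ : List (List Srt)} → {Γ : List Srt} → Formula S Δ Γ →
      HList (fun T => Tup A T → Prop) Δ → Tup A Γ → Prop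
  | _, _, .rel R x, _, v => 𝔄.rel R (values v x)
  | _, _, .rvar Y x, X, v => proj Y X (values v x)
  | _, _, .eq x y, _, v => proj x v = proj y v
  | _, _, .le μ ν, _, v => (proj μ v).val ≤ (proj ν v).val
  | _, _, .neg φ, X, v => ¬ φ.Holds 𝔄 X v
  | _, _, .and φ ψ, X, v => φ.Holds 𝔄 X v ∧ ψ.Holds 𝔄 X v
  | _, _, .all a φ, X, v => ∀ b : Dom A a, φ.Holds 𝔄 X (.cons b v)
  | _, _, .count φ μ, X, v =>
      Nat.card {b : A // φ.Holds 𝔄 X (.cons (.element b) v)} = (proj μ v).val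
  | _, _, .ifp T φ x, X, v =>
      ∃ n : ℕ, stage (fun (Y : Tup A T → Prop) (y : Tup A T) => φ.Holds 𝔄 (.cons Y X) (append y v)) n
        (values v x)
  | _, _, .ord P T φ μ, X, v =>
      (Nat.card (spanGroup fun (a : Tup A P) (b c : Tup A T) =>
        φ.Holds 𝔄 X (append a (append b (append c v))))).testBit (index (values v μ)) = true

/-- The group generated by the permutations that `φ(p, s, t)` defines on `𝔄` for some value
of `p`. -/
def generated {S : Signature.{w}} {A : Type u} (𝔄 : Str S A) {P T : List Srt}
    (φ : Formula S [] (P ++ (T ++ T))) : Subgroup (Equiv.Perm (Tup A T)) :=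
  spanGroup fun (a : Tup A P) (b c : Tup A T) =>
    φ.Holds 𝔄 .nil (append a (append b c))

/-- `φ(R, x, y)` defines the morphism `m : G → Sym(A^{T'})` on `𝔄`: for all `σ ∈ G`, the relation
defined by `φ` on `(𝔄, graph(σ))` is the graph of `m(σ)`. -/
def DefinesMorphism {S : Signature.{w}} {A : Type u} (𝔄 : Str S A) {T T' : List Srt}
    (φ : Formula S [T ++ T] (T' ++ T')) {G : Subgroup (Equiv.Perm (Tup A T))}
    (m : G →* Equiv.Perm (Tup A T')) : Prop :=
  ∀ σ : G, ∀ w : Tup A (T' ++ T'),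
    φ.Holds 𝔄 (.cons (graph (σ : Equiv.Perm (Tup A T))) .nil) w ↔ graph (m σ) w

end FPOrd

/-! By the isomorphism theorem |ker m| = |G| / |im m|, and both orders on the right are orders of
definable groups. For im m, substitute φ_G(p, ·, ·) for R in φ_m, for those p where φ_G defines a
permutation: the results are the images of the generators (`spanGroup_imageRel`). It remains to
divide two numbers whose binary expansions are definable. Membership needs no division: τ ∈ G iff
adjoining τ to the generators leaves the order unchanged (`spanGroup_adjoinRel`), and for τ ∈ G,
m(τ) = 1 iff φ_m defines a subset of the diagonal.

Long division in fixed-point logic needs the order of bit positions. Digits run from 0 to |A| while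
the base is |A|, so different tuples may have the same index, and the lexicographic order is not the
order of indices. The `ord` operator itself settles this. Transpositions indexed by a definable set
of c elements and acting on disjoint pairs generate a group of order 2^c, so the bits of 2^c are
definable. As `index μ` is the size of a definable set (`card_isBelow`), equations between sums of
indices become equations between powers of two, and the order follows (`Definable.index_add_eq`,
`Definable.index_le`). The remainders of long division are then an inflationary fixed point
(`stage_divisionStep`, `Definable.testBit_div`).

The arity 2|T| may offer too few positions for |G| on small domains. Letting the groups act on
longer tuples (`card_spanGroup_pad`) gives both orders a common arity with room to spare
(`two_mul_card_subgroup_le`). The empty domain is treated separately. Formulae are not written out: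
`Definable` is a semantic notion, closed under the needed operations. -/

namespace FPOrd

/-! ### Tuples -/

section Tuples

variable {α : Type z} {F : α → Type u}

/-- The first component of a nonempty tuple. -/
def head {a : α} {l : List α} : HList F (a :: l) → F a
  | .cons x _ => x

/-- All components of a nonempty tuple but the first. -/
def tail {a : α} {l : List α} : HList F (a :: l) → HList F l
  | .cons _ xs => xs

@[simp] theorem head_cons {a : α} {l : List α} (x : F a) (xs : HList F l) :
    head (.cons x xs) = x := rfl

@[simp] theorem tail_cons {a : α} {l : List α} (x : F a) (xs : HList F l) :
    tail (.cons x xs) = xs := rfl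

@[simp] theorem cons_head_tail {a : α} {l : List α} (v : HList F (a :: l)) :
    HList.cons (head v) (tail v) = v := by
  cases v; rfl

theorem hlist_nil_eq (v : HList F []) : v = .nil := by
  cases v; rfl

/-- The left part of a concatenated tuple. -/
def fst : {l l' : List α} → HList F (l ++ l') → HList F l
  | [], _, _ => .nil
  | _ :: _, _, .cons x xs => .cons x (fst xs)

/-- The right part of a concatenated tuple. -/
def snd : {l l' : List α} → HList F (l ++ l') → HList F l'
  | [], _, v => v
  | _ :: l, _, .cons _ xs => snd (l := l) xs

@[simp] theorem fst_append {l l' : List α} (x : HList F l) (y : HList F l') :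
    fst (append x y) = x := by
  induction x with
  | nil => rfl
  | cons a x ih => exact congrArg (HList.cons a) ih

@[simp] theorem snd_append {l l' : List α} (x : HList F l) (y : HList F l') :
    snd (append x y) = y := by
  induction x with
  | nil => rfl
  | cons a x ih => exact ih

@[simp] theorem append_fst_snd : {l l' : List α} → (v : HList F (l ++ l')) →
    append (fst v) (snd v) = v
  | [], _, _ => rfl
  | _ :: l, _, .cons x xs => congrArg (HList.cons x) (append_fst_snd (l := l) xs)

/-- Tuples over a concatenated word are pairs of tuples. -/
def appendEquiv (F : α → Type u) (l l' : List α) : HList F l × HList F l' ≃ HList F (l ++ l') where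
  toFun p := append p.1 p.2
  invFun v := (fst v, snd v)
  left_inv p := by simp
  right_inv v := by simp

/-- Tuples over a nonempty word are pairs of an entry and a tuple. -/
def consEquiv (F : α → Type u) (a : α) (l : List α) : F a × HList F l ≃ HList F (a :: l) where
  toFun p := .cons p.1 p.2
  invFun v := (head v, tail v)
  left_inv p := by simp
  right_inv v := by simp

theorem append_inj {l l' : List α} {x x' : HList F l} {y y' : HList F l'} :
    append x y = append x' y' ↔ x = x' ∧ y = y' := by
  rw [← Prod.mk.injEq]
  exact (appendEquiv F l l').injective.eq_iff (a := (x, y)) (b := (x', y'))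

/-- Weakening of variables by one new variable in front. -/
def shift {Γ : List α} (b : α) : {T : List α} → HList (Idx Γ) T → HList (Idx (b :: Γ)) T
  | _, .nil => .nil
  | _, .cons x xs => .cons (.succ x) (shift b xs)

@[simp] theorem values_shift {Γ T : List α} {b : α} (x : F b) (v : HList F Γ)
    (ρ : HList (Idx Γ) T) : values (HList.cons x v) (shift b ρ) = values v ρ := by
  induction ρ with
  | nil => rfl
  | cons i ρ ih => exact congrArg (HList.cons (proj i v)) ih

/-- The variables of the left part of a context. -/
def inl : {T Γ : List α} → HList (Idx (T ++ Γ)) T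
  | [], _ => .nil
  | t :: T, Γ => .cons .zero (shift t (inl (T := T) (Γ := Γ)))

/-- All variables of a context. -/
def vars : {Γ : List α} → HList (Idx Γ) Γ
  | [] => .nil
  | t :: _ => .cons .zero (shift t vars)

/-- The variables of the right part of a context. -/
def inr : {T Γ : List α} → HList (Idx (T ++ Γ)) Γ
  | [], _ => vars
  | t :: T, Γ => shift t (inr (T := T) (Γ := Γ))

@[simp] theorem values_vars {Γ : List α} (v : HList F Γ) : values v vars = v := by
  induction v with
  | nil => rfl
  | cons x v ih => simp [vars, values, proj, ih]

@[simp] theorem values_inl : {T Γ : List α} → (v : HList F (T ++ Γ)) → values v inl = fst v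
  | [], _, _ => rfl
  | _ :: T, _, .cons x v => by
    simp only [inl, values, fst, proj]
    exact congrArg (HList.cons x) ((values_shift x v _).trans (values_inl (T := T) v))

@[simp] theorem values_inr : {T Γ : List α} → (v : HList F (T ++ Γ)) → values v inr = snd v
  | [], _, v => values_vars v
  | _ :: T, _, .cons x v => by
    simp only [inr, snd]
    exact (values_shift x v _).trans (values_inr (T := T) v)

theorem proj_values {Γ T : List α} {a : α} (v : HList F Γ) (ρ : HList (Idx Γ) T) (i : Idx T a) :
    proj i (values v ρ) = proj (proj i ρ) v := by
  induction ρ with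
  | nil => cases i
  | cons j ρ ih =>
    cases i with
    | zero => rfl
    | succ i => exact ih i

theorem values_values {Γ T U : List α} (v : HList F Γ) (ρ : HList (Idx Γ) T)
    (x : HList (Idx T) U) : values (values v ρ) x = values v (values ρ x) := by
  induction x with
  | nil => rfl
  | cons i x ih => simp [values, ih, proj_values]

@[simp] theorem values_append {Γ T U : List α} (v : HList F Γ) (x : HList (Idx Γ) T)
    (y : HList (Idx Γ) U) : values v (append x y) = append (values v x) (values v y) := by
  induction x with
  | nil => rfl
  | cons i x ih => exact congrArg (HList.cons (proj i v)) ih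

end Tuples

/-- Lifting of a renaming under binders for a tuple of type `T`. -/
def lift {α : Type z} (T : List α) {Γ Γ' : List α} (ρ : HList (Idx Γ') Γ) :
    HList (Idx (T ++ Γ')) (T ++ Γ) :=
  append inl (values inr ρ)

theorem values_lift {α : Type z} {F : α → Type u} {T Γ Γ' : List α} (ρ : HList (Idx Γ') Γ)
    (x : HList F T) (v : HList F Γ') :
    values (append x v) (lift T ρ) = append x (values v ρ) := by
  simp [lift, ← values_values]

theorem values_lift_one {α : Type z} {F : α → Type u} {b : α} {Γ Γ' : List α}
    (ρ : HList (Idx Γ') Γ) (x : F b) (v : HList F Γ') :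
    values (HList.cons x v) (lift [b] ρ) = HList.cons x (values v ρ) :=
  values_lift ρ (HList.cons x .nil) v

/-! ### Definable queries -/

/-- A finite nonempty structure. -/
structure Model (S : Signature.{w}) : Type (max (u + 1) w) where
  A : Type u
  fin : Finite A
  ne : Nonempty A
  str : Str S A

attribute [instance] Model.fin Model.ne

/-- An interpretation of relation variables. -/
abbrev Env (A : Type u) (Δ : List (List Srt)) : Type u := HList (fun T => Tup A T → Prop) Δ

variable {S : Signature.{w}}

/-- A family of relations is definable if some formula defines it on all finite nonempty
structures. -/
def Definable {Δ : List (List Srt)} {Γ : List Srt}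
    (Q : ∀ M : Model.{u} S, Env M.A Δ → Tup M.A Γ → Prop) : Prop :=
  ∃ φ : Formula S Δ Γ, ∀ M X v, φ.Holds M.str X v ↔ Q M X v

/-- A family of maps between tuples that is given by a choice of variables. -/
def IsBlock {Γ T : List Srt} (f : ∀ M : Model.{u} S, Tup M.A Γ → Tup M.A T) : Prop :=
  ∃ x : HList (Idx Γ) T, ∀ M v, f M v = values v x

/-- A family of entries of tuples that is given by a variable. -/
def IsVar {Γ : List Srt} {a : Srt} (f : ∀ M : Model.{u} S, Tup M.A Γ → Dom M.A a) : Prop :=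
  ∃ x : Idx Γ a, ∀ M v, f M v = proj x v

/-- Source of weakening and of substitution of variables for `Definable`. Renaming passes under
binders because `lift` fixes the newly bound variables. -/
theorem Formula.exists_rename {Δ : List (List Srt)} {Γ : List Srt} (φ : Formula S Δ Γ) :
    ∀ {Δ' : List (List Srt)} {Γ' : List Srt} (r : HList (Idx Δ') Δ) (ρ : HList (Idx Γ') Γ),
      ∃ ψ : Formula S Δ' Γ', ∀ (A : Type u) (𝔄 : Str S A) (X : Env A Δ') (v : Tup A Γ'),
        ψ.Holds 𝔄 X v ↔ φ.Holds 𝔄 (values X r) (values v ρ) := by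
  induction φ with
  | rel R x => exact fun r ρ => ⟨.rel R (values ρ x), fun A 𝔄 X v => by
      simp only [Holds, values_values]⟩
  | rvar Y x => exact fun r ρ => ⟨.rvar (proj Y r) (values ρ x), fun A 𝔄 X v => by
      simp only [Holds, values_values, proj_values]⟩
  | eq x y => exact fun r ρ => ⟨.eq (proj x ρ) (proj y ρ), fun A 𝔄 X v => by
      simp only [Holds, proj_values]⟩
  | le x y => exact fun r ρ => ⟨.le (proj x ρ) (proj y ρ), fun A 𝔄 X v => by
      simp only [Holds, proj_values]⟩
  | neg φ ih =>
    intro Δ' Γ' r ρ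
    obtain ⟨ψ, h⟩ := ih r ρ
    exact ⟨.neg ψ, fun A 𝔄 X v => by simp only [Holds, h]⟩
  | and φ₁ φ₂ ih₁ ih₂ =>
    intro Δ' Γ' r ρ
    obtain ⟨ψ₁, h₁⟩ := ih₁ r ρ
    obtain ⟨ψ₂, h₂⟩ := ih₂ r ρ
    exact ⟨.and ψ₁ ψ₂, fun A 𝔄 X v => by simp only [Holds, h₁, h₂]⟩
  | all a φ ih =>
    intro Δ' Γ' r ρ
    obtain ⟨ψ, h⟩ := ih r (lift [a] ρ)
    exact ⟨.all a ψ, fun A 𝔄 X v => by simp only [Holds, h, values_lift_one]⟩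
  | count φ μ ih =>
    intro Δ' Γ' r ρ
    obtain ⟨ψ, h⟩ := ih r (lift [_] ρ)
    exact ⟨.count ψ (proj μ ρ), fun A 𝔄 X v => by
      simp only [Holds, h, values_lift_one, proj_values]⟩
  | ifp T φ x ih =>
    intro Δ' Γ' r ρ
    obtain ⟨ψ, h⟩ := ih (lift [T] r) (lift T ρ)
    exact ⟨.ifp T ψ (values ρ x), fun A 𝔄 X v => by
      simp only [Holds, h, values_lift, values_lift_one, values_values]⟩
  | ord P T φ μ ih =>
    intro Δ' Γ' r ρ
    obtain ⟨ψ, h⟩ := ih r (lift P (lift T (lift T ρ)))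
    exact ⟨.ord P T ψ (values ρ μ), fun A 𝔄 X v => by
      simp only [Holds, h, values_lift, values_values]⟩

namespace IsBlock

variable {Γ T U : List Srt} {a : Srt}

theorem id : IsBlock (S := S) fun M (v : Tup M.A Γ) => v := ⟨vars, by simp⟩

theorem comp {f : ∀ M : Model.{u} S, Tup M.A T → Tup M.A U} (hf : IsBlock f)
    {g : ∀ M : Model.{u} S, Tup M.A Γ → Tup M.A T} (hg : IsBlock g) :
    IsBlock fun M v => f M (g M v) := by
  obtain ⟨x, hx⟩ := hf
  obtain ⟨y, hy⟩ := hg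
  exact ⟨values y x, fun M v => by simp only [hx, hy, values_values]⟩

theorem fst {f : ∀ M : Model.{u} S, Tup M.A Γ → Tup M.A (T ++ U)} (hf : IsBlock f) :
    IsBlock fun M v => FPOrd.fst (f M v) :=
  comp (f := fun M v => FPOrd.fst v) ⟨inl, by simp⟩ hf

theorem snd {f : ∀ M : Model.{u} S, Tup M.A Γ → Tup M.A (T ++ U)} (hf : IsBlock f) :
    IsBlock fun M v => FPOrd.snd (f M v) :=
  comp (f := fun M v => FPOrd.snd v) ⟨inr, by simp⟩ hf

theorem tail {f : ∀ M : Model.{u} S, Tup M.A Γ → Tup M.A (a :: T)} (hf : IsBlock f) :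
    IsBlock fun M v => FPOrd.tail (f M v) := by
  refine comp (f := fun M v => FPOrd.tail v) ⟨shift a vars, fun M v => ?_⟩ hf
  cases v; simp

theorem append {f : ∀ M : Model.{u} S, Tup M.A Γ → Tup M.A T} (hf : IsBlock f)
    {g : ∀ M : Model.{u} S, Tup M.A Γ → Tup M.A U} (hg : IsBlock g) :
    IsBlock fun M v => FPOrd.append (f M v) (g M v) := by
  obtain ⟨x, hx⟩ := hf
  obtain ⟨y, hy⟩ := hg
  exact ⟨FPOrd.append x y, fun M v => by simp only [hx, hy, values_append]⟩

theorem cons {f : ∀ M : Model.{u} S, Tup M.A Γ → Dom M.A a} (hf : IsVar f)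
    {g : ∀ M : Model.{u} S, Tup M.A Γ → Tup M.A T} (hg : IsBlock g) :
    IsBlock fun M v => HList.cons (f M v) (g M v) := by
  obtain ⟨x, hx⟩ := hf
  obtain ⟨y, hy⟩ := hg
  exact ⟨.cons x y, fun M v => by simp only [hx, hy, values]⟩

end IsBlock

theorem IsVar.head {Γ T : List Srt} {a : Srt} {f : ∀ M : Model.{u} S, Tup M.A Γ → Tup M.A (a :: T)}
    (hf : IsBlock f) : IsVar fun M v => FPOrd.head (f M v) := by
  obtain ⟨x, hx⟩ := hf
  refine ⟨proj .zero x, fun M v => ?_⟩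
  simp only [hx, ← proj_values]
  cases values v x
  rfl

namespace Definable

variable {Δ : List (List Srt)} {Γ T U : List Srt} {a : Srt}

theorem congr {Q Q' : ∀ M : Model.{u} S, Env M.A Δ → Tup M.A Γ → Prop} (h : Definable Q)
    (e : ∀ M X v, Q' M X v ↔ Q M X v) : Definable Q' := by
  obtain ⟨φ, hφ⟩ := h
  exact ⟨φ, fun M X v => (hφ M X v).trans (e M X v).symm⟩

theorem holds (φ : Formula S Δ Γ) :
    Definable fun (M : Model.{u} S) (X : Env M.A Δ) v => φ.Holds M.str X v :=
  ⟨φ, fun _ _ _ => Iff.rfl⟩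

/-- Substitution of variables in a definable query. -/
theorem comp {Q : ∀ M : Model.{u} S, Env M.A Δ → Tup M.A T → Prop} (h : Definable Q)
    {f : ∀ M : Model.{u} S, Tup M.A Γ → Tup M.A T} (hf : IsBlock f) :
    Definable fun M X v => Q M X (f M v) := by
  obtain ⟨φ, hφ⟩ := h
  obtain ⟨x, hx⟩ := hf
  obtain ⟨ψ, hψ⟩ := Formula.exists_rename.{u, w} φ vars x
  exact ⟨ψ, fun M X v => by simp only [hψ, values_vars, hφ, hx]⟩

/-- Weakening by a relation variable. -/
theorem weaken {Q : ∀ M : Model.{u} S, Env M.A Δ → Tup M.A Γ → Prop} (h : Definable Q) :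
    Definable fun M (X : Env M.A (T :: Δ)) v => Q M (tail X) v := by
  obtain ⟨φ, hφ⟩ := h
  obtain ⟨ψ, hψ⟩ := Formula.exists_rename.{u, w} φ (shift T vars) vars
  refine ⟨ψ, fun M X v => ?_⟩
  cases X
  simp only [hψ, values_vars, values_shift, hφ, tail_cons]

theorem not {Q : ∀ M : Model.{u} S, Env M.A Δ → Tup M.A Γ → Prop} (h : Definable Q) :
    Definable fun M X v => ¬ Q M X v := by
  obtain ⟨φ, hφ⟩ := h
  exact ⟨.neg φ, fun M X v => by simp only [Formula.Holds, hφ]⟩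

section Connectives

variable {Q R : ∀ M : Model.{u} S, Env M.A Δ → Tup M.A Γ → Prop}

theorem and (hQ : Definable Q) (hR : Definable R) : Definable fun M X v => Q M X v ∧ R M X v := by
  obtain ⟨φ, hφ⟩ := hQ
  obtain ⟨ψ, hψ⟩ := hR
  exact ⟨.and φ ψ, fun M X v => by simp only [Formula.Holds, hφ, hψ]⟩

theorem or (hQ : Definable Q) (hR : Definable R) : Definable fun M X v => Q M X v ∨ R M X v :=
  (hQ.not.and hR.not).not.congr fun _ _ _ => by tauto

theorem imp (hQ : Definable Q) (hR : Definable R) : Definable fun M X v => Q M X v → R M X v :=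
  (hQ.and hR.not).not.congr fun _ _ _ => by tauto

theorem iff (hQ : Definable Q) (hR : Definable R) : Definable fun M X v => (Q M X v ↔ R M X v) :=
  ((hQ.imp hR).and (hR.imp hQ)).congr fun _ _ _ => by tauto

end Connectives

theorem all_one {Q : ∀ M : Model.{u} S, Env M.A Δ → Dom M.A a → Tup M.A Γ → Prop}
    (h : Definable (Γ := a :: Γ) fun M X w => Q M X (head w) (tail w)) :
    Definable fun M X v => ∀ x : Dom M.A a, Q M X x v := by
  obtain ⟨φ, hφ⟩ := h
  exact ⟨.all a φ, fun M X v => by simp [Formula.Holds, hφ]⟩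

theorem ex_one {Q : ∀ M : Model.{u} S, Env M.A Δ → Dom M.A a → Tup M.A Γ → Prop}
    (h : Definable (Γ := a :: Γ) fun M X w => Q M X (head w) (tail w)) :
    Definable fun M X v => ∃ x : Dom M.A a, Q M X x v :=
  (all_one (Q := fun M X x v => ¬ Q M X x v) h.not).not.congr fun _ _ _ => by simp

theorem all {T : List Srt} : ∀ {Γ : List Srt}
    {Q : ∀ M : Model.{u} S, Env M.A Δ → Tup M.A T → Tup M.A Γ → Prop}
    (_ : Definable (Γ := T ++ Γ) fun M X w => Q M X (fst w) (snd w)),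
    Definable fun M X v => ∀ x : Tup M.A T, Q M X x v := by
  induction T with
  | nil =>
    intro Γ Q h
    exact h.congr fun M X v => ⟨fun H => H _, fun H x => by rw [hlist_nil_eq x]; exact H⟩
  | cons t T ih =>
    intro Γ Q h
    -- Quantifying over `t` outside and `T` inside leaves the `t`-variable behind the `T`-block in
    -- the context, so the variables are permuted.
    have h' : Definable (Γ := T ++ (t :: Γ)) fun M X w =>
        Q M X (.cons (head (snd w)) (fst w)) (tail (snd w)) := by
      have := h.comp (f := fun M (w : Tup M.A (T ++ (t :: Γ))) =>
        FPOrd.append (HList.cons (head (snd w)) (fst w)) (tail (snd w)))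
        ((IsBlock.cons (.head IsBlock.id.snd) IsBlock.id.fst).append IsBlock.id.snd.tail)
      exact this.congr fun M X w => by rw [fst_append, snd_append]
    refine (all_one (Q := fun M X y v => ∀ x : Tup M.A T, Q M X (.cons y x) v)
      (ih (Q := fun M X x w => Q M X (.cons (head w) x) (tail w)) h')).congr fun M X v => ?_
    exact ⟨fun H y x => H _, fun H x => by rw [← cons_head_tail x]; exact H _ _⟩

theorem ex {Q : ∀ M : Model.{u} S, Env M.A Δ → Tup M.A T → Tup M.A Γ → Prop}
    (h : Definable (Γ := T ++ Γ) fun M X w => Q M X (fst w) (snd w)) :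
    Definable fun M X v => ∃ x : Tup M.A T, Q M X x v :=
  (all (Q := fun M X x v => ¬ Q M X x v) h.not).not.congr fun _ _ _ => by simp

theorem eq_var {f g : ∀ M : Model.{u} S, Tup M.A Γ → Dom M.A a} (hf : IsVar f) (hg : IsVar g) :
    Definable fun M (_ : Env M.A Δ) v => f M v = g M v := by
  obtain ⟨x, hx⟩ := hf
  obtain ⟨y, hy⟩ := hg
  exact ⟨.eq x y, fun M X v => by simp only [Formula.Holds, hx, hy]⟩

theorem le {f g : ∀ M : Model.{u} S, Tup M.A Γ → Dom M.A Srt.number} (hf : IsVar f)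
    (hg : IsVar g) : Definable fun M (_ : Env M.A Δ) v => (f M v).val ≤ (g M v).val := by
  obtain ⟨x, hx⟩ := hf
  obtain ⟨y, hy⟩ := hg
  exact ⟨.le x y, fun M X v => by simp only [Formula.Holds, hx, hy]⟩

theorem lt {f g : ∀ M : Model.{u} S, Tup M.A Γ → Dom M.A Srt.number} (hf : IsVar f)
    (hg : IsVar g) : Definable fun M (_ : Env M.A Δ) v => (f M v).val < (g M v).val :=
  (le hg hf).not.congr fun _ _ _ => not_le.symm

theorem const_true : Definable fun (M : Model.{u} S) (_ : Env M.A Δ) (_ : Tup M.A Γ) => True :=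
  (all_one (a := .number) (Q := fun M X x v => x = x)
    (eq_var (.head .id) (.head .id))).congr fun _ _ _ => by simp

theorem eq : ∀ {T : List Srt} {f g : ∀ M : Model.{u} S, Tup M.A Γ → Tup M.A T}, IsBlock f →
    IsBlock g → Definable fun M (_ : Env M.A Δ) v => f M v = g M v
  | [], f, g, _, _ => const_true.congr fun M X v => by
      rw [hlist_nil_eq (f M v), hlist_nil_eq (g M v)]; simp
  | t :: T, f, g, hf, hg => ((eq_var (.head hf) (.head hg)).and (eq hf.tail hg.tail)).congr
      fun M X v => by
        cases f M v
        cases g M v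
        simp

theorem rvar (Y : Idx Δ T) {f : ∀ M : Model.{u} S, Tup M.A Γ → Tup M.A T} (hf : IsBlock f) :
    Definable fun M (X : Env M.A Δ) v => proj Y X (f M v) := by
  obtain ⟨x, hx⟩ := hf
  exact ⟨.rvar Y x, fun M X v => by simp only [Formula.Holds, hx]⟩

theorem ord {P : List Srt}
    {Φ : ∀ M : Model.{u} S, Env M.A Δ → Tup M.A P → Tup M.A T → Tup M.A T → Tup M.A Γ → Prop}
    (hΦ : Definable (Γ := P ++ (T ++ (T ++ Γ))) fun M X w =>
      Φ M X (fst w) (fst (snd w)) (fst (snd (snd w))) (snd (snd (snd w))))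
    {f : ∀ M : Model.{u} S, Tup M.A Γ → Tup M.A (numbers (2 * T.length))} (hf : IsBlock f) :
    Definable fun M X v =>
      (Nat.card (spanGroup fun a b c => Φ M X a b c v)).testBit (index (f M v)) = true := by
  obtain ⟨φ, hφ⟩ := hΦ
  obtain ⟨x, hx⟩ := hf
  exact ⟨.ord P T φ x, fun M X v => by simp only [Formula.Holds, hφ, hx, fst_append, snd_append]⟩

theorem ifp {F : ∀ M : Model.{u} S, Env M.A Δ → (Tup M.A T → Prop) → Tup M.A T → Tup M.A Γ → Prop}
    (hF : Definable (Δ := T :: Δ) (Γ := T ++ Γ) fun M X w =>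
      F M (tail X) (head X) (fst w) (snd w))
    {f : ∀ M : Model.{u} S, Tup M.A Γ → Tup M.A T} (hf : IsBlock f) :
    Definable fun M X v => ∃ n, stage (fun Y y => F M X Y y v) n (f M v) := by
  obtain ⟨φ, hφ⟩ := hF
  obtain ⟨x, hx⟩ := hf
  exact ⟨.ifp T φ x, fun M X v => by
    simp only [Formula.Holds, hφ, hx, fst_append, snd_append, head_cons, tail_cons]⟩

end Definable

/-- Substitution of definable relations for the relation variables of a formula. -/
theorem Formula.definable_subst {Δ : List (List Srt)} {Γ : List Srt} (φ : Formula S Δ Γ) :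
    ∀ {Δ' : List (List Srt)} {Γ' : List Srt} (ρ : HList (Idx Γ') Γ)
      (D : ∀ M : Model.{u} S, Env M.A Δ' → Tup M.A Γ' → Env M.A Δ)
      (_ : ∀ (T : List Srt) (Y : Idx Δ T), Definable (Γ := T ++ Γ') fun M X w =>
        proj Y (D M X (snd w)) (fst w)),
      Definable fun M X v => φ.Holds M.str (D M X v) (values v ρ) := by
  induction φ with
  | rel R x => exact fun ρ D hD => ⟨.rel R (values ρ x), fun M X v => by
      simp only [Holds, values_values]⟩
  | rvar Y x =>
    intro Δ' Γ' ρ D hD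
    refine ((hD _ Y).comp (f := fun M v => append (values v (values ρ x)) v)
      (.append ⟨_, fun _ _ => rfl⟩ .id)).congr fun M X v => ?_
    simp only [Holds, values_values, snd_append, fst_append]
  | eq x y => exact fun ρ D hD => ⟨.eq (proj x ρ) (proj y ρ), fun M X v => by
      simp only [Holds, proj_values]⟩
  | le x y => exact fun ρ D hD => ⟨.le (proj x ρ) (proj y ρ), fun M X v => by
      simp only [Holds, proj_values]⟩
  | neg φ ih =>
    intro Δ' Γ' ρ D hD
    exact (ih ρ D hD).not
  | and φ₁ φ₂ ih₁ ih₂ =>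
    intro Δ' Γ' ρ D hD
    exact (ih₁ ρ D hD).and (ih₂ ρ D hD)
  | all a φ ih =>
    intro Δ' Γ' ρ D hD
    refine (Definable.all_one (Q := fun M X x v => φ.Holds M.str (D M X v) (.cons x (values v ρ)))
      ((ih (lift [a] ρ) (fun M X v => D M X (tail v)) fun T Y => ?_).congr fun M X v => ?_)).congr
      fun M X v => Iff.rfl
    · refine ((hD T Y).comp (f := fun M w => append (fst w) (tail (snd w)))
        (.append (IsBlock.id.fst) (IsBlock.id.snd.tail))).congr fun M X v => ?_
      simp
    · cases v
      rw [values_lift_one]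
      rfl
  | count φ μ ih =>
    intro Δ' Γ' ρ D hD
    obtain ⟨ψ, hψ⟩ := ih (lift [_] ρ) (fun M X v => D M X (tail v)) fun T Y =>
      ((hD T Y).comp (f := fun M w => append (fst w) (tail (snd w)))
        (.append (IsBlock.id.fst) (IsBlock.id.snd.tail))).congr fun M X v => by simp
    exact ⟨.count ψ (proj μ ρ), fun M X v => by
      simp only [Holds, hψ, values_lift_one, proj_values, tail_cons]⟩
  | ifp T φ x ih =>
    intro Δ' Γ' ρ D hD
    -- The fixed-point variable stands for itself; the substituted relations see neither it nor the
    -- tuple bound with it.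
    obtain ⟨ψ, hψ⟩ := ih (Δ' := T :: Δ') (lift T ρ)
      (fun M X v => .cons (head X) (D M (tail X) (snd v))) fun U Y => by
        cases Y with
        | zero =>
          exact (Definable.rvar (Idx.zero (a := T) (l := Δ')) (IsBlock.id.fst)).congr
            fun M X v => by cases X; rfl
        | succ Y =>
          refine (((hD U Y).weaken (T := T)).comp (f := fun M w => append (fst w) (snd (snd w)))
            (.append (IsBlock.id.fst) (IsBlock.id.snd.snd))).congr fun M X v => ?_
          simp [proj]
    exact ⟨.ifp T ψ (values ρ x), fun M X v => by
      simp only [Holds, hψ, values_lift, values_values, head_cons, tail_cons, snd_append]⟩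
  | ord P T φ μ ih =>
    intro Δ' Γ' ρ D hD
    obtain ⟨ψ, hψ⟩ := ih (lift P (lift T (lift T ρ)))
      (fun M X v => D M X (snd (snd (snd v)))) fun U Y =>
      ((hD U Y).comp (f := fun M w => append (fst w) (snd (snd (snd (snd w)))))
        (.append (IsBlock.id.fst) (IsBlock.id.snd.snd.snd.snd))).congr fun M X v => by simp
    exact ⟨.ord P T ψ (values ρ μ), fun M X v => by
      simp only [Holds, hψ, values_lift, values_values, snd_append]⟩

/-! ### Groups generated by disjoint transpositions -/

theorem viaEmbedding_swap {α β : Type*} [DecidableEq α] [DecidableEq β] (e : α ↪ β) (a b : α) :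
    (Equiv.swap a b).viaEmbedding e = Equiv.swap (e a) (e b) := by
  ext x
  by_cases hx : x ∈ Set.range e
  · obtain ⟨y, rfl⟩ := hx
    rw [Equiv.Perm.viaEmbedding_apply, e.injective.swap_apply]
  · rw [Equiv.Perm.viaEmbedding_apply_of_notMem _ _ _ hx, Equiv.swap_apply_of_ne_of_ne]
    · rintro rfl; exact hx ⟨a, rfl⟩
    · rintro rfl; exact hx ⟨b, rfl⟩

theorem sigmaCongrRight_mulSingle_swap {γ : Type*} [DecidableEq γ] (s : γ) :
    Equiv.Perm.sigmaCongrRight (Pi.mulSingle s (Equiv.swap false true) : γ → Equiv.Perm Bool) =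
      Equiv.swap (⟨s, false⟩ : Σ _ : γ, Bool) ⟨s, true⟩ := by
  refine Equiv.ext fun ⟨i, b⟩ => ?_
  by_cases h : i = s
  · subst h
    cases b <;> simp
  · simp [Equiv.swap_apply_def, h]

/-- Disjoint transpositions are independent: the generated group is an injective image of the
product of copies of Sym({0,1}), one copy for each element of `γ`. -/
theorem card_closure_swap {γ β : Type*} [Finite γ] [DecidableEq β] (e : (Σ _ : γ, Bool) ↪ β) :
    Nat.card (Subgroup.closure (Set.range fun s : γ =>
      Equiv.swap (e ⟨s, false⟩) (e ⟨s, true⟩))) = 2 ^ Nat.card γ := by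
  classical
  let f : (γ → Equiv.Perm Bool) →* Equiv.Perm β :=
    (Equiv.Perm.viaEmbeddingHom e).comp (Equiv.Perm.sigmaCongrRightHom fun _ : γ => Bool)
  have hf : ∀ s, f (Pi.mulSingle s (Equiv.swap false true)) =
      Equiv.swap (e ⟨s, false⟩) (e ⟨s, true⟩) := fun s => by
    rw [← viaEmbedding_swap, ← sigmaCongrRight_mulSingle_swap]
    rfl
  have hinj : Function.Injective f :=
    (Equiv.Perm.viaEmbeddingHom_injective e).comp Equiv.Perm.sigmaCongrRightHom_injective
  have hrange : Subgroup.closure (Set.range fun s : γ =>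
      Equiv.swap (e ⟨s, false⟩) (e ⟨s, true⟩)) = f.range := by
    refine le_antisymm ((Subgroup.closure_le _).2 ?_) ?_
    · rintro _ ⟨s, rfl⟩
      exact ⟨_, hf s⟩
    · rintro _ ⟨x, rfl⟩
      rw [← Subgroup.mem_comap]
      refine Subgroup.pi_mem_of_mulSingle_mem x fun s => ?_
      have : x s = 1 ∨ x s = Equiv.swap false true := by
        generalize x s = σ
        revert σ
        decide
      rcases this with h | h <;> rw [h]
      · simp [one_mem]
      · rw [Subgroup.mem_comap, hf]
        exact Subgroup.subset_closure ⟨s, rfl⟩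
  rw [hrange, ← Nat.card_congr (MonoidHom.ofInjective hinj).toEquiv, Nat.card_fun]
  simp [Nat.card_eq_fintype_card, Fintype.card_perm]

/-! ### Numerical tuples -/

section Numbers

variable {A : Type u}

theorem Dom.val_le (x : Dom A .number) : x.val ≤ Nat.card A := by
  cases x with
  | number i => exact Nat.le_of_lt_succ i.2

theorem Dom.val_injective : Function.Injective (Dom.val (A := A)) := by
  rintro ⟨i⟩ ⟨j⟩ h
  exact congrArg Dom.number (Fin.ext h)

theorem Dom.exists_val {i : ℕ} (h : i ≤ Nat.card A) : ∃ x : Dom A .number, x.val = i :=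
  ⟨.number ⟨i, Nat.lt_succ_of_le h⟩, rfl⟩

/-- Numbers are the elements of `Fin (|A| + 1)`. -/
def domNumberEquiv (A : Type u) : Dom A .number ≃ Fin (Nat.card A + 1) where
  toFun | .number i => i
  invFun := .number
  left_inv := by rintro ⟨i⟩; rfl
  right_inv _ := rfl

/-- Domain elements, as the range of element variables. -/
def domElementEquiv (A : Type u) : Dom A .element ≃ A where
  toFun | .element a => a
  invFun := .element
  left_inv := by rintro ⟨i⟩; rfl
  right_inv _ := rfl

instance [Finite A] : (a : Srt) → Finite (Dom A a)
  | .element => Finite.of_equiv _ (domElementEquiv A).symm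
  | .number => Finite.of_equiv _ (domNumberEquiv A).symm

instance [Nonempty A] : (a : Srt) → Nonempty (Dom A a)
  | .element => (domElementEquiv A).nonempty
  | .number => (domNumberEquiv A).nonempty

instance {α : Type z} {F : α → Type u} [∀ a, Finite (F a)] (l : List α) :
    Finite (HList F l) := by
  induction l with
  | nil =>
    have : Subsingleton (HList F []) := ⟨fun v v' => by rw [hlist_nil_eq v, hlist_nil_eq v']⟩
    infer_instance
  | cons a l ih => exact Finite.of_equiv _ (consEquiv F a l)

instance {α : Type z} {F : α → Type u} [∀ a, Nonempty (F a)] (l : List α) :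
    Nonempty (HList F l) := by
  induction l with
  | nil => exact ⟨.nil⟩
  | cons a l ih => exact (consEquiv F a l).symm.nonempty

theorem card_dom_le [Finite A] : (a : Srt) → Nat.card (Dom A a) ≤ Nat.card A + 1
  | .element => by rw [Nat.card_congr (domElementEquiv A)]; exact Nat.le_succ _
  | .number => by rw [Nat.card_congr (domNumberEquiv A), Nat.card_fin]

theorem card_tup_le [Finite A] (T : List Srt) :
    Nat.card (Tup A T) ≤ (Nat.card A + 1) ^ T.length := by
  induction T with
  | nil =>
    have : Subsingleton (Tup A []) := ⟨fun v v' => by rw [hlist_nil_eq v, hlist_nil_eq v']⟩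
    exact Finite.card_le_one_iff_subsingleton.2 this
  | cons a T ih =>
    rw [← Nat.card_congr (consEquiv _ a T), Nat.card_prod, List.length_cons, pow_succ, mul_comm]
    exact Nat.mul_le_mul ih (card_dom_le a)

/-- The largest number that is encoded by a `k`-tuple of elements of `{0, …, n}`. -/
def maxIndex (n : ℕ) : ℕ → ℕ
  | 0 => 0
  | k + 1 => n ^ k * n + maxIndex n k

theorem index_cons {k : ℕ} (x : Dom A .number) (μ : Tup A (numbers k)) :
    index (k := k + 1) (.cons x μ) = Nat.card A ^ k * x.val + index μ := rfl

theorem index_le : ∀ {k : ℕ} (μ : Tup A (numbers k)), index μ ≤ maxIndex (Nat.card A) k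
  | 0, _ => le_rfl
  | _ + 1, .cons x _ => Nat.add_le_add (Nat.mul_le_mul_left _ x.val_le) (index_le _)

theorem pow_le_maxIndex_succ (n : ℕ) : ∀ k, n ^ k ≤ maxIndex n k + 1
  | 0 => by simp [maxIndex]
  | k + 1 => by rw [maxIndex, pow_succ, add_assoc]; exact Nat.le_add_right _ _

/-- Positions have no gaps, although the encoding is redundant. Greedily, the leading digit is |A|
if `i` is large enough, and otherwise the quotient by |A|^k. -/
theorem exists_index : ∀ {k i : ℕ}, i ≤ maxIndex (Nat.card A) k →
    ∃ μ : Tup A (numbers k), index μ = i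
  | 0, i, h => ⟨.nil, (Nat.le_zero.1 h).symm⟩
  | k + 1, i, h => by
    rw [maxIndex] at h
    by_cases h' : Nat.card A ^ k * Nat.card A ≤ i
    · obtain ⟨x, hx⟩ := Dom.exists_val (A := A) le_rfl
      obtain ⟨μ, hμ⟩ := exists_index (k := k) (i := i - Nat.card A ^ k * Nat.card A)
        (Nat.sub_le_iff_le_add'.2 h)
      exact ⟨.cons x μ, by rw [index_cons, hx, hμ, Nat.add_sub_cancel' h']⟩
    · have h' := not_le.1 h'
      have hpos : 0 < Nat.card A ^ k := Nat.pos_of_ne_zero fun h0 => by simp [h0] at h'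
      obtain ⟨x, hx⟩ := Dom.exists_val (A := A) (Nat.div_lt_of_lt_mul h').le
      obtain ⟨μ, hμ⟩ := exists_index (k := k) (i := i % Nat.card A ^ k)
        (Nat.le_of_lt_succ ((Nat.mod_lt i hpos).trans_le (pow_le_maxIndex_succ _ k)))
      exact ⟨.cons x μ, by rw [index_cons, hx, hμ, Nat.div_add_mod]⟩

/-- Each of the `c` leading digits contributes at least `n ^ j`. Additional digits thus buy a
constant factor even when `n = 1`, where powers do not grow. -/
theorem mul_pow_le_maxIndex {n : ℕ} (hn : 0 < n) (j : ℕ) : ∀ c, c * n ^ j ≤ maxIndex n (j + c)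
  | 0 => by simp
  | c + 1 => by
    rw [← add_assoc, maxIndex, ← pow_succ, add_mul, one_mul, add_comm]
    exact Nat.add_le_add (Nat.pow_le_pow_right hn (by omega)) (mul_pow_le_maxIndex hn j c)

theorem maxIndex_mono (n k c : ℕ) : maxIndex n k ≤ maxIndex n (k + c) := by
  induction c with
  | zero => exact le_rfl
  | succ c ih => exact ih.trans (Nat.le_add_left _ _)

/-- All entries of a numerical tuple are less than `|A|`. -/
def IsSmall : {k : ℕ} → Tup A (numbers k) → Prop
  | 0, _ => True
  | k + 1, b => (∃ x : Dom A .number, (head b).val < x.val) ∧ IsSmall (k := k) (tail b)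

/-- A set of `k`-tuples with exactly `index μ` elements. -/
def IsBelow : {k : ℕ} → Tup A (numbers k) → Tup A (numbers k) → Prop
  | 0, _, _ => False
  | k + 1, μ, b => ((head b).val < (head μ).val ∧ IsSmall (k := k) (tail b)) ∨
      (∀ x : Dom A .number, x.val ≤ (head b).val) ∧ IsBelow (k := k) (tail μ) (tail b)

theorem Dom.exists_val_lt_iff (x : Dom A .number) :
    (∃ y : Dom A .number, x.val < y.val) ↔ x.val < Nat.card A :=
  ⟨fun ⟨y, h⟩ => h.trans_le y.val_le, fun h =>
    let ⟨y, hy⟩ := Dom.exists_val (A := A) le_rfl; ⟨y, hy ▸ h⟩⟩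

theorem Dom.forall_val_le_iff (x : Dom A .number) :
    (∀ y : Dom A .number, y.val ≤ x.val) ↔ x.val = Nat.card A := by
  have := x.exists_val_lt_iff.not
  simp only [not_exists, not_lt] at this
  exact this.trans ⟨fun h => le_antisymm x.val_le h, fun h => h.ge⟩

theorem Dom.le_forall_val_iff (x : Dom A .number) :
    (∀ y : Dom A .number, x.val ≤ y.val) ↔ x.val = 0 := by
  refine ⟨fun h => ?_, fun h y => h ▸ Nat.zero_le _⟩
  obtain ⟨y, hy⟩ := Dom.exists_val (A := A) (Nat.zero_le _)
  exact Nat.le_zero.1 (hy ▸ h y)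

theorem Dom.card_val_lt {m : ℕ} (hm : m ≤ Nat.card A) :
    Nat.card {x : Dom A .number // x.val < m} = m := by
  rw [Nat.card_congr (β := Fin m) ⟨fun x => ⟨x.1.val, x.2⟩,
    fun i => ⟨.number ⟨i, by omega⟩, i.2⟩, fun x => Subtype.ext (Dom.val_injective rfl),
    fun _ => rfl⟩, Nat.card_fin]

theorem card_isSmall : ∀ k : ℕ,
    Nat.card {b : Tup A (numbers k) // IsSmall b} = Nat.card A ^ k
  | 0 => by
    rw [pow_zero, Nat.card_eq_one_iff_unique]
    exact ⟨⟨fun v v' => Subtype.ext (by rw [hlist_nil_eq v.1, hlist_nil_eq v'.1])⟩,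
      ⟨⟨.nil, trivial⟩⟩⟩
  | k + 1 => by
    have e : {x : Dom A .number // x.val < Nat.card A} × {b : Tup A (numbers k) // IsSmall b} ≃
        {b : Tup A (numbers (k + 1)) // IsSmall b} :=
      ⟨fun p => ⟨.cons p.1.1 p.2.1, p.1.1.exists_val_lt_iff.2 p.1.2, p.2.2⟩,
        fun b => (⟨head b.1, (Dom.exists_val_lt_iff _).1 b.2.1⟩, ⟨tail b.1, b.2.2⟩),
        fun _ => rfl, fun b => Subtype.ext (cons_head_tail _)⟩
    rw [← Nat.card_congr e, Nat.card_prod, card_isSmall k, Dom.card_val_lt le_rfl, pow_succ,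
      mul_comm]

/-- A leading digit below that of `μ` leaves |A|^k small tails. The digit |A| is never below it,
which makes it a free tag for the recursion on the tail. -/
theorem card_isBelow [Finite A] : ∀ {k : ℕ} (μ : Tup A (numbers k)),
    Nat.card {b : Tup A (numbers k) // IsBelow μ b} = index μ
  | 0, x => by
    have : IsEmpty {b : Tup A (numbers 0) // IsBelow x b} := ⟨fun b => b.2⟩
    exact Nat.card_of_isEmpty
  | k + 1, μ => by
    obtain ⟨t, ht⟩ := Dom.exists_val (A := A) le_rfl
    let f : {x : Dom A .number // x.val < (head μ).val} × {b : Tup A (numbers k) // IsSmall b} ⊕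
        {b : Tup A (numbers k) // IsBelow (tail μ) b} →
        {b : Tup A (numbers (k + 1)) // IsBelow μ b} :=
      Sum.elim (fun p => ⟨.cons p.1.1 p.2.1, .inl ⟨p.1.2, p.2.2⟩⟩)
        (fun b => ⟨.cons t b.1, .inr ⟨t.forall_val_le_iff.2 ht, b.2⟩⟩)
    have hf : f.Bijective := by
      refine ⟨?_, ?_⟩
      · have hlt : ∀ x : {x : Dom A .number // x.val < (head μ).val}, x.1 ≠ t := fun x h => by
          have := x.2.trans_le (head μ).val_le
          rw [h, ht] at this
          exact this.false
        rintro (⟨x, b⟩ | b) (⟨x', b'⟩ | b') h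
        · have h := Subtype.mk.inj h
          have h1 : x.1 = x'.1 := congrArg head h
          have h2 : b.1 = b'.1 := congrArg tail h
          rw [Subtype.ext h1, Subtype.ext h2]
        · exact (hlt x (congrArg head (Subtype.mk.inj h))).elim
        · exact (hlt x' (congrArg head (Subtype.mk.inj h)).symm).elim
        · have h2 : b.1 = b'.1 := congrArg tail (Subtype.mk.inj h)
          rw [Subtype.ext h2]
      · rintro ⟨b, ⟨h1, h2⟩ | ⟨h1, h2⟩⟩
        · exact ⟨.inl (⟨head b, h1⟩, ⟨tail b, h2⟩), Subtype.ext (cons_head_tail _)⟩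
        · refine ⟨.inr ⟨tail b, h2⟩, Subtype.ext ?_⟩
          have : t = head b :=
            Dom.val_injective (ht.trans ((head b).forall_val_le_iff.1 h1).symm)
          exact (congrArg (fun y => HList.cons y (tail b)) this).trans (cons_head_tail _)
    rw [← Nat.card_congr (Equiv.ofBijective f hf), Nat.card_sum, Nat.card_prod, card_isSmall,
      Dom.card_val_lt (head μ).val_le, card_isBelow (tail μ), mul_comm]
    cases μ
    rfl

end Numbers

/-! ### The order of positions is definable -/

namespace Definable

variable {Δ : List (List Srt)} {Γ T U V : List Srt}

theorem comp₂ {Q : ∀ M : Model.{u} S, Env M.A Δ → Tup M.A T → Tup M.A U → Prop}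
    (h : Definable (Γ := T ++ U) fun M X w => Q M X (fst w) (snd w))
    {f : ∀ M : Model.{u} S, Tup M.A Γ → Tup M.A T} (hf : IsBlock f)
    {g : ∀ M : Model.{u} S, Tup M.A Γ → Tup M.A U} (hg : IsBlock g) :
    Definable fun M X v => Q M X (f M v) (g M v) :=
  (h.comp (hf.append hg)).congr fun M X v => by simp

theorem comp₃ {Q : ∀ M : Model.{u} S, Env M.A Δ → Tup M.A T → Tup M.A U → Tup M.A V → Prop}
    (h : Definable (Γ := T ++ (U ++ V)) fun M X w => Q M X (fst w) (fst (snd w)) (snd (snd w)))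
    {e : ∀ M : Model.{u} S, Tup M.A Γ → Tup M.A T} (he : IsBlock e)
    {f : ∀ M : Model.{u} S, Tup M.A Γ → Tup M.A U} (hf : IsBlock f)
    {g : ∀ M : Model.{u} S, Tup M.A Γ → Tup M.A V} (hg : IsBlock g) :
    Definable fun M X v => Q M X (e M v) (f M v) (g M v) :=
  (h.comp (he.append (hf.append hg))).congr fun M X v => by simp

end Definable

/-- The transposition of `(z, a)` and `(t, a)`, for the elements `a` of the set `s`. -/
def swapRel {A : Type u} {U : List Srt} (z t : Dom A .number) (s : Tup A U → Prop) (a : Tup A U)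
    (b c : Tup A (.number :: U)) : Prop :=
  s a ∧ (b = .cons z a ∧ c = .cons t a ∨ b = .cons t a ∧ c = .cons z a ∨
    ¬ b = .cons z a ∧ ¬ b = .cons t a ∧ b = c)

/-- Parameters outside `s` yield the empty relation, which is no graph since there are tuples; hence
they contribute no generator. -/
theorem card_spanGroup_swapRel {A : Type u} [Finite A] [Nonempty A] {U : List Srt}
    {z t : Dom A .number} (hzt : z ≠ t) (s : Tup A U → Prop) :
    Nat.card (spanGroup (swapRel z t s)) = 2 ^ Nat.card {a // s a} := by
  classical
  let e : (Σ _ : {a // s a}, Bool) ↪ Tup A (.number :: U) :=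
    ⟨fun p => .cons (if p.2 then t else z) p.1.1, by
      rintro ⟨⟨a, ha⟩, i⟩ ⟨⟨a', ha'⟩, i'⟩ h
      simp only [HList.cons.injEq] at h
      obtain ⟨h, rfl⟩ := h
      cases i <;> cases i' <;> simp_all⟩
  rw [← card_closure_swap e]
  suffices h : {σ : Equiv.Perm (Tup A (.number :: U)) | ∃ a, ∀ b c, swapRel z t s a b c ↔ σ b = c} =
      Set.range fun a : {a // s a} => Equiv.swap (e ⟨a, false⟩) (e ⟨a, true⟩) by
    rw [spanGroup, h]
  have key : ∀ (a : {a // s a}) b c, swapRel z t s a.1 b c ↔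
      Equiv.swap (e ⟨a, false⟩) (e ⟨a, true⟩) b = c := by
    rintro ⟨a, ha⟩ b c
    have hz : e ⟨⟨a, ha⟩, false⟩ = .cons z a := rfl
    have ht : e ⟨⟨a, ha⟩, true⟩ = .cons t a := rfl
    have hne : HList.cons (F := Dom A) z a ≠ .cons t a := fun h => hzt (congrArg head h)
    rw [hz, ht, Equiv.swap_apply_def, swapRel]
    split_ifs with h1 h2
    · simp [h1, ha, hne, eq_comm]
    · simp [h2, ha, hne.symm, eq_comm]
    · simp [h1, h2, ha]
  ext σ
  constructor
  · rintro ⟨a, h⟩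
    have ha : s a := ((h (Classical.arbitrary _) _).2 rfl).1
    exact ⟨⟨a, ha⟩, Equiv.ext fun b => ((key ⟨a, ha⟩ b _).1 ((h b _).2 rfl))⟩
  · rintro ⟨a, rfl⟩
    exact ⟨a.1, key a⟩

theorem card_disjoint_union {A : Type u} [Finite A] {U : List Srt} {z t : Dom A .number}
    (hzt : z ≠ t) (p q : Tup A U → Prop) :
    Nat.card {b : Tup A (.number :: U) // head b = z ∧ p (tail b) ∨ head b = t ∧ q (tail b)} =
      Nat.card {b // p b} + Nat.card {b // q b} := by
  rw [← Nat.card_sum]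
  refine (Nat.card_congr (Equiv.ofBijective (Sum.elim
    (fun a => ⟨.cons z a.1, .inl ⟨rfl, a.2⟩⟩)
    (fun a => ⟨.cons t a.1, .inr ⟨rfl, a.2⟩⟩)) ⟨?_, ?_⟩)).symm
  · rintro (a | a) (a' | a') h <;> have h := Subtype.mk.inj h
    · rw [Subtype.ext (congrArg tail h : a.1 = a'.1)]
    · exact (hzt (congrArg head h)).elim
    · exact (hzt (congrArg head h).symm).elim
    · rw [Subtype.ext (congrArg tail h : a.1 = a'.1)]
  · rintro ⟨b, ⟨rfl, h⟩ | ⟨rfl, h⟩⟩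
    · exact ⟨.inl ⟨tail b, h⟩, Subtype.ext (cons_head_tail b)⟩
    · exact ⟨.inr ⟨tail b, h⟩, Subtype.ext (cons_head_tail b)⟩

theorem Definable.isSmall {Δ : List (List Srt)} {Γ : List Srt} : ∀ {k : ℕ}
    {f : ∀ M : Model.{u} S, Tup M.A Γ → Tup M.A (numbers k)} (_ : IsBlock f),
    Definable fun M (_ : Env M.A Δ) v => IsSmall (f M v)
  | 0, _, _ => const_true
  | k + 1, f, hf => (ex_one (Q := fun M _ x v => (head (f M v)).val < x.val)
      (lt (.head (hf.comp (T := Γ) IsBlock.id.tail)) (.head .id))).and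
    (isSmall (k := k) hf.tail)

theorem Definable.isBelow {Δ : List (List Srt)} {Γ : List Srt} : ∀ {k : ℕ}
    {f g : ∀ M : Model.{u} S, Tup M.A Γ → Tup M.A (numbers k)} (_ : IsBlock f) (_ : IsBlock g),
    Definable fun M (_ : Env M.A Δ) v => IsBelow (f M v) (g M v)
  | 0, _, _, _, _ => const_true.not.congr fun _ _ _ => by simp [IsBelow]
  | k + 1, f, g, hf, hg => ((lt (.head hg) (.head hf)).and (isSmall (k := k) hg.tail)).or
    ((all_one (Q := fun M X x v => x.val ≤ (head (g M v)).val)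
      (le (.head .id) (.head (hg.comp (T := Γ) IsBlock.id.tail)))).and
      (isBelow (k := k) hf.tail hg.tail))

theorem Definable.swapRel {Δ : List (List Srt)} {Γ U : List Srt}
    {s : ∀ M : Model.{u} S, Env M.A Δ → Tup M.A Γ → Tup M.A U → Prop}
    {e : ∀ M : Model.{u} S, Tup M.A Γ → Tup M.A U}
    (hs : Definable fun M X w => s M X w (e M w)) (he : IsBlock e)
    {y t : ∀ M : Model.{u} S, Tup M.A Γ → Dom M.A .number} (hy : IsVar y) (ht : IsVar t)
    {f g : ∀ M : Model.{u} S, Tup M.A Γ → Tup M.A (.number :: U)} (hf : IsBlock f)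
    (hg : IsBlock g) :
    Definable fun M X v => FPOrd.swapRel (y M v) (t M v) (s M X v) (e M v) (f M v) (g M v) :=
  have h₁ := eq (Δ := Δ) hf (.cons hy he)
  have h₂ := eq (Δ := Δ) hf (.cons ht he)
  hs.and ((h₁.and (eq hg (.cons ht he))).or ((h₂.and (eq hg (.cons hy he))).or
    (h₁.not.and (h₂.not.and (eq hf hg)))))

/-- The bits of `2 ^ c`, for the number `c` of elements of a definable set, are definable. -/
theorem Definable.testBit_two_pow_card {Δ : List (List Srt)} {Γ U : List Srt}
    {s : ∀ M : Model.{u} S, Env M.A Δ → Tup M.A U → Tup M.A Γ → Prop}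
    (hs : Definable (Γ := U ++ Γ) fun M X w => s M X (fst w) (snd w))
    {f : ∀ M : Model.{u} S, Tup M.A Γ → Tup M.A (numbers (2 * (Srt.number :: U).length))}
    (hf : IsBlock f) :
    Definable fun M X v => (2 ^ Nat.card {a // s M X a v}).testBit (index (f M v)) = true := by
  -- The tags are the least number 0 and the greatest number |A|; they differ because the domain is
  -- nonempty.
  refine (ex_one (a := .number) (Q := fun M X y v => ∃ t : Dom M.A .number,
    (∀ x : Dom M.A .number, y.val ≤ x.val) ∧ (∀ x : Dom M.A .number, x.val ≤ t.val) ∧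
    (Nat.card (spanGroup (FPOrd.swapRel y t fun a => s M X a v))).testBit (index (f M v)) = true)
    (ex_one (Q := fun M X t w => (∀ x : Dom M.A .number, (head w).val ≤ x.val) ∧
      (∀ x : Dom M.A .number, x.val ≤ t.val) ∧
      (Nat.card (spanGroup (FPOrd.swapRel (head w) t fun a => s M X a (tail w)))).testBit
        (index (f M (tail w))) = true) ?_)).congr ?_
  · refine .and (all_one (Q := fun M X x w => (head (tail w)).val ≤ x.val)
      (le (.head IsBlock.id.tail.tail) (.head .id)))
      (.and (all_one (Q := fun M X x w => x.val ≤ (head w).val)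
      (le (.head .id) (.head IsBlock.id.tail))) (ord (Φ := fun M X a b c w =>
        FPOrd.swapRel (head (tail w)) (head w) (fun a => s M X a (tail (tail w))) a b c) ?_
        (hf.comp IsBlock.id.tail.tail)))
    exact swapRel (s := fun M X w a => s M X a (tail (tail (snd (snd (snd w))))))
      (comp₂ hs IsBlock.id.fst IsBlock.id.snd.snd.snd.tail.tail) IsBlock.id.fst
      (.head IsBlock.id.snd.snd.snd.tail) (.head IsBlock.id.snd.snd.snd) IsBlock.id.snd.fst
      IsBlock.id.snd.snd.fst
  · intro M X v
    have hpos : 0 < Nat.card M.A := Nat.card_pos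
    obtain ⟨y, hy⟩ := Dom.exists_val (A := M.A) (Nat.zero_le _)
    obtain ⟨t, ht⟩ := Dom.exists_val (A := M.A) le_rfl
    constructor
    · intro h
      refine ⟨y, t, fun x => hy ▸ Nat.zero_le _, t.forall_val_le_iff.2 ht, ?_⟩
      rwa [card_spanGroup_swapRel]
      rintro rfl
      omega
    · rintro ⟨y', t', h1, h2, h3⟩
      rwa [card_spanGroup_swapRel] at h3
      rintro rfl
      have := h1 y
      have := y'.forall_val_le_iff.1 h2
      omega

/-- Two definable sets, of sizes `index e + index f` and `index g`, are compared through the bits of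
2 to the power of their sizes. -/
theorem Definable.index_add_eq {Δ : List (List Srt)} {Γ : List Srt} {k : ℕ}
    {e f g : ∀ M : Model.{u} S, Tup M.A Γ → Tup M.A (numbers k)} (he : IsBlock e) (hf : IsBlock f)
    (hg : IsBlock g) :
    Definable fun M (_ : Env M.A Δ) v => index (e M v) + index (f M v) = index (g M v) := by
  let s₁ (M : Model.{u} S) (v : Tup M.A Γ) (b : Tup M.A (numbers (k + 1))) : Prop :=
    (∀ x : Dom M.A .number, (head b).val ≤ x.val) ∧ IsBelow (k := k) (e M v) (tail b) ∨
      (∀ x : Dom M.A .number, x.val ≤ (head b).val) ∧ IsBelow (k := k) (f M v) (tail b)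
  -- The empty second summand gives `s₂` the shape of `s₁`, so that `card_disjoint_union` counts
  -- both.
  let s₂ (M : Model.{u} S) (v : Tup M.A Γ) (b : Tup M.A (numbers (k + 1))) : Prop :=
    (∀ x : Dom M.A .number, (head b).val ≤ x.val) ∧ IsBelow (k := k) (g M v) (tail b) ∨
      (∀ x : Dom M.A .number, x.val ≤ (head b).val) ∧ False
  have hzero : Definable fun (M : Model.{u} S) (_ : Env M.A Δ)
      (w : Tup M.A (numbers (k + 1) ++ Γ)) => ∀ x : Dom M.A .number, (head (fst w)).val ≤ x.val :=
    all_one (Q := fun (M : Model.{u} S) _ x (w : Tup M.A (numbers (k + 1) ++ Γ)) =>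
      (head (fst w)).val ≤ x.val)
      (le (.head (T := numbers k) (IsBlock.fst (T := numbers (k + 1)) IsBlock.id.tail)) (.head .id))
  have htop : Definable fun (M : Model.{u} S) (_ : Env M.A Δ)
      (w : Tup M.A (numbers (k + 1) ++ Γ)) => ∀ x : Dom M.A .number, x.val ≤ (head (fst w)).val :=
    all_one (Q := fun (M : Model.{u} S) _ x (w : Tup M.A (numbers (k + 1) ++ Γ)) =>
      x.val ≤ (head (fst w)).val)
      (le (.head .id) (.head (T := numbers k) (IsBlock.fst (T := numbers (k + 1)) IsBlock.id.tail)))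
  have htail : IsBlock fun M : Model.{u} S => fun (w : Tup M.A (numbers (k + 1) ++ Γ)) =>
      tail (l := numbers k) (fst w) :=
    IsBlock.tail (T := numbers k) (IsBlock.fst (T := numbers (k + 1)) .id)
  have hs₁ : Definable fun M (_ : Env M.A Δ) (w : Tup M.A (numbers (k + 1) ++ Γ)) =>
      s₁ M (snd w) (fst w) :=
    .or (hzero.and (isBelow (he.comp IsBlock.id.snd) htail))
      (htop.and (isBelow (hf.comp IsBlock.id.snd) htail))
  have hs₂ : Definable fun M (_ : Env M.A Δ) (w : Tup M.A (numbers (k + 1) ++ Γ)) =>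
      s₂ M (snd w) (fst w) :=
    .or (hzero.and (isBelow (hg.comp IsBlock.id.snd) htail))
      (htop.and (const_true.not.congr fun _ _ _ => by simp))
  let K := 2 * (Srt.number :: numbers (k + 1)).length
  refine (all (T := numbers K) (Q := fun M (X : Env M.A Δ) ξ v =>
    ((2 ^ Nat.card {a // s₁ M v a}).testBit (index ξ) = true ↔
      (2 ^ Nat.card {a // s₂ M v a}).testBit (index ξ) = true))
    (.iff (testBit_two_pow_card (s := fun M X a w => s₁ M (snd w) a)
      (comp₂ (Q := fun M X a w => s₁ M w a) hs₁ IsBlock.id.fst IsBlock.id.snd.snd) IsBlock.id.fst)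
      (testBit_two_pow_card (s := fun M X a w => s₂ M (snd w) a)
      (comp₂ (Q := fun M X a w => s₂ M w a) hs₂ IsBlock.id.fst IsBlock.id.snd.snd)
        IsBlock.id.fst))).congr fun M X v => ?_
  have hpos : 0 < Nat.card M.A := Nat.card_pos
  obtain ⟨y, hy⟩ := Dom.exists_val (A := M.A) (Nat.zero_le _)
  obtain ⟨t, ht⟩ := Dom.exists_val (A := M.A) le_rfl
  have hy' : ∀ x : Dom M.A .number, (∀ x' : Dom M.A .number, x.val ≤ x'.val) ↔ x = y := fun x =>
    ⟨fun h => Dom.val_injective (by have := h y; omega), fun h x' => by rw [h, hy]; omega⟩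
  have ht' : ∀ x : Dom M.A .number, (∀ x' : Dom M.A .number, x'.val ≤ x.val) ↔ x = t := fun x =>
    x.forall_val_le_iff.trans ⟨fun h => Dom.val_injective (h.trans ht.symm), fun h => h ▸ ht⟩
  have hyt : y ≠ t := by
    rintro rfl
    omega
  have h₁ : Nat.card {a // s₁ M v a} = index (e M v) + index (f M v) := by
    simp only [s₁, hy', ht']
    refine (card_disjoint_union hyt (fun b : Tup M.A (numbers k) => IsBelow (e M v) b)
      (fun b : Tup M.A (numbers k) => IsBelow (f M v) b)).trans ?_
    rw [card_isBelow, card_isBelow]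
  have h₂ : Nat.card {a // s₂ M v a} = index (g M v) := by
    simp only [s₂, hy', ht']
    refine (card_disjoint_union hyt (fun b : Tup M.A (numbers k) => IsBelow (g M v) b)
      (fun _ : Tup M.A (numbers k) => False)).trans ?_
    rw [card_isBelow, Nat.card_of_isEmpty, add_zero]
  simp only [h₁, h₂]
  refine ⟨fun h ξ => by rw [h], fun h => ?_⟩
  -- Arity `K ≥ k` makes the position `index g` visible. The only 1 of the right-hand power is
  -- there, so agreement at this position already forces equal exponents.
  have hK : K = k + (k + 4) := by simp [K]; omega
  obtain ⟨ξ, hξ⟩ := exists_index (A := M.A) (k := K) (i := index (g M v))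
    ((index_le _).trans (hK ▸ maxIndex_mono _ k _))
  have := (h ξ).2 (by rw [hξ, Nat.testBit_two_pow_self])
  rw [hξ, Nat.testBit_two_pow] at this
  exact of_decide_eq_true this

/-- The difference of two indices is again an index, as positions have no gaps. -/
theorem Definable.index_le {Δ : List (List Srt)} {Γ : List Srt} {k : ℕ}
    {f g : ∀ M : Model.{u} S, Tup M.A Γ → Tup M.A (numbers k)} (hf : IsBlock f) (hg : IsBlock g) :
    Definable fun M (_ : Env M.A Δ) v => index (f M v) ≤ index (g M v) := by
  refine (ex (T := numbers k) (Q := fun M X ρ v => index (f M v) + index ρ = index (g M v))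
    (index_add_eq (hf.comp IsBlock.id.snd) IsBlock.id.fst (hg.comp IsBlock.id.snd))).congr
    fun M X v => ⟨fun h => ?_, fun ⟨ρ, h⟩ => h ▸ Nat.le_add_right _ _⟩
  obtain ⟨ρ, hρ⟩ := exists_index (A := M.A) (k := k) (i := index (g M v) - index (f M v))
    ((Nat.sub_le _ _).trans (FPOrd.index_le _))
  exact ⟨ρ, by omega⟩

/-! ### Binary arithmetic -/

/-- The highest differing bit decides; the induction splits off bit `i`. -/
theorem testBit_mod_lt_iff (x y i : ℕ) : x % 2 ^ i < y % 2 ^ i ↔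
    ∃ l < i, ¬ x.testBit l = true ∧ y.testBit l = true ∧
      ∀ l', l < l' → l' < i → (x.testBit l' = true ↔ y.testBit l' = true) := by
  induction i with
  | zero => simp [Nat.mod_one]
  | succ i ih =>
    have hx := Nat.mod_lt x (Nat.two_pow_pos i)
    have hy := Nat.mod_lt y (Nat.two_pow_pos i)
    have key : x % 2 ^ (i + 1) < y % 2 ^ (i + 1) ↔
        (¬ x.testBit i = true ∧ y.testBit i = true) ∨
        ((x.testBit i = true ↔ y.testBit i = true) ∧ x % 2 ^ i < y % 2 ^ i) := by
      have e (z : ℕ) : z % 2 ^ (i + 1) = z % 2 ^ i + 2 ^ i * (z.testBit i).toNat := by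
        rw [Nat.mod_pow_succ, Nat.testBit_eq_decide_div_mod_eq]
        rcases Nat.mod_two_eq_zero_or_one (z / 2 ^ i) with h | h <;> simp [h]
      rw [e x, e y]
      cases x.testBit i <;> cases y.testBit i <;> simp <;> omega
    rw [key, ih]
    constructor
    · rintro (h | ⟨h, l, hl, h1, h2, h3⟩)
      · exact ⟨i, Nat.lt_succ_self i, h.1, h.2, fun l' h1 h2 => by omega⟩
      · refine ⟨l, by omega, h1, h2, fun l' h4 h5 => ?_⟩
        rcases (Nat.lt_succ_iff_lt_or_eq.1 h5) with h6 | rfl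
        · exact h3 l' h4 h6
        · exact h
    · rintro ⟨l, hl, h1, h2, h3⟩
      rcases (Nat.lt_succ_iff_lt_or_eq.1 hl) with h4 | rfl
      · exact .inr ⟨h3 i h4 (Nat.lt_succ_self i), l, h4, h1, h2,
          fun l' h5 h6 => h3 l' h5 (by omega)⟩
      · exact .inl ⟨h1, h2⟩

/-- Schoolbook subtraction: the bit is the exclusive or of both bits and the borrow, and a borrow
enters position `i` iff `x % 2 ^ i < y % 2 ^ i`. -/
theorem testBit_sub_iff {x y : ℕ} (h : y ≤ x) (i : ℕ) : (x - y).testBit i = true ↔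
    ((x.testBit i = true ↔ y.testBit i = true) ↔ x % 2 ^ i < y % 2 ^ i) := by
  simp only [Nat.testBit_eq_decide_div_mod_eq, decide_eq_true_eq]
  have hp := Nat.two_pow_pos i
  generalize 2 ^ i = p at *
  have hx := Nat.div_add_mod x p
  have hy := Nat.div_add_mod y p
  have hr := Nat.mod_lt x hp
  have hs := Nat.mod_lt y hp
  have hle : y / p ≤ x / p := Nat.div_le_div_right h
  generalize x / p = a at *
  generalize y / p = b at *
  generalize x % p = r at *
  generalize y % p = s at *
  obtain ⟨c, rfl⟩ := Nat.exists_eq_add_of_le hle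
  subst hx hy
  rw [mul_add] at h ⊢
  by_cases hrs : r < s
  · have hc : 0 < c := Nat.pos_of_ne_zero fun h0 => by subst h0; omega
    obtain ⟨d, rfl⟩ := Nat.exists_eq_succ_of_ne_zero hc.ne'
    have : p * b + p * d.succ + r - (p * b + s) = (p + r - s) + p * d := by
      rw [Nat.mul_succ]; omega
    rw [this, Nat.add_mul_div_left _ _ hp, Nat.div_eq_of_lt (by omega)]
    simp only [hrs, iff_true]
    omega
  · have : p * b + p * c + r - (p * b + s) = (r - s) + p * c := by omega
    rw [this, Nat.add_mul_div_left _ _ hp, Nat.div_eq_of_lt (by omega)]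
    simp only [hrs, iff_false]
    omega

theorem div_two_pow_eq (a j : ℕ) :
    a / 2 ^ j = 2 * (a / 2 ^ (j + 1)) + (a.testBit j).toNat := by
  rw [pow_succ, ← Nat.div_div_eq_div_mul, Nat.testBit_eq_decide_div_mod_eq]
  rcases Nat.mod_two_eq_zero_or_one (a / 2 ^ j) with h | h <;> simp [h] <;> omega

/-- A step of the long division of `a` by `b`. -/
theorem div_two_pow_mod (a b j : ℕ) : a / 2 ^ j % b =
    (2 * (a / 2 ^ (j + 1) % b) + (a.testBit j).toNat) % b := by
  rw [div_two_pow_eq a j]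
  simp [Nat.add_mod, Nat.mul_mod]

/-- Long division: bit `j` is 1 exactly when `b` fits into the previous remainder with the next bit
of `a` brought down. The quotient can therefore be read off the remainders. -/
theorem testBit_div_iff (a j : ℕ) {b : ℕ} (hb : 0 < b) : (a / b).testBit j = true ↔
    ¬ 2 * (a / 2 ^ (j + 1) % b) + (a.testBit j).toNat < b := by
  have hr := Nat.mod_lt (a / 2 ^ (j + 1)) hb
  have hq := Nat.div_add_mod (a / 2 ^ (j + 1)) b
  have hβ := Bool.toNat_le (a.testBit j)
  rw [Nat.testBit_eq_decide_div_mod_eq, Nat.div_div_eq_div_mul, mul_comm, ← Nat.div_div_eq_div_mul,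
    div_two_pow_eq a j, decide_eq_true_eq]
  generalize a / 2 ^ (j + 1) / b = q at *
  generalize a / 2 ^ (j + 1) % b = r at *
  rw [← hq, show 2 * (b * q + r) + (a.testBit j).toNat =
      (2 * r + (a.testBit j).toNat) + b * (2 * q) by
    ring, Nat.add_mul_div_left _ _ hb]
  generalize (a.testBit j).toNat = β at *
  by_cases h : 2 * r + β < b
  · simp [Nat.div_eq_of_lt h, h]
  · have : (2 * r + β) / b = 1 := Nat.div_eq_of_lt_le (by omega) (by omega)
    exact ⟨fun _ => h, fun _ => by rw [this]; omega⟩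

theorem testBit_two_mul_add (r i : ℕ) (β : Bool) : (2 * r + β.toNat).testBit i = true ↔
    i = 0 ∧ β = true ∨ ∃ i', i = i' + 1 ∧ r.testBit i' = true := by
  cases i with
  | zero => cases β <;> simp [Nat.testBit_zero, Nat.add_mod]
  | succ i =>
    rw [Nat.testBit_succ, show (2 * r + β.toNat) / 2 = r by cases β <;> grind]
    simp

theorem mod_eq_ite {x b : ℕ} (h : x < 2 * b) : x % b = if x < b then x else x - b := by
  split_ifs with h'
  · exact Nat.mod_eq_of_lt h'
  · rw [Nat.mod_eq_sub_mod (by omega), Nat.mod_eq_of_lt (by omega)]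

/-! ### Binary arithmetic on sets of positions -/

section Bits

variable {A : Type u} {k : ℕ}

/-- The comparison of two binary numbers, restricted to the positions below `i`. -/
def LessBelow (p q : Tup A (numbers k) → Prop) (i : Tup A (numbers k)) : Prop :=
  ∃ l : Tup A (numbers k), index l < index i ∧ ¬ p l ∧ q l ∧
    ∀ l' : Tup A (numbers k), index l < index l' → index l' < index i → (p l' ↔ q l')

/-- The comparison of two binary numbers. -/
def Less (p q : Tup A (numbers k) → Prop) : Prop :=
  ∃ t : Tup A (numbers k), (∀ l : Tup A (numbers k), index l ≤ index t) ∧ LessBelow p q t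

/-- `j` is the position after `i`. -/
def IsNext (i j : Tup A (numbers k)) : Prop :=
  index i < index j ∧ ∀ l : Tup A (numbers k), index i < index l → index j ≤ index l

/-- The binary number `2 r + β`. -/
def DoubleAdd (r : Tup A (numbers k) → Prop) (β : Prop) (i : Tup A (numbers k)) : Prop :=
  (∀ l : Tup A (numbers k), index i ≤ index l) ∧ β ∨
    ∃ i' : Tup A (numbers k), IsNext i' i ∧ r i'

/-- The remainder of a binary number modulo another one of more than half its size. -/
def Reduce (p q : Tup A (numbers k) → Prop) (i : Tup A (numbers k)) : Prop :=
  Less p q ∧ p i ∨ ¬ Less p q ∧ ((p i ↔ q i) ↔ LessBelow p q i)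

theorem index_le_all_iff (t : Tup A (numbers k)) :
    (∀ l : Tup A (numbers k), index l ≤ index t) ↔ index t = maxIndex (Nat.card A) k := by
  refine ⟨fun h => le_antisymm (index_le t) ?_, fun h l => h ▸ index_le l⟩
  obtain ⟨l, hl⟩ := exists_index (A := A) (k := k) le_rfl
  exact hl ▸ h l

/-- Rests on `exists_index`. A position may have several successors, all of the same index. -/
theorem isNext_iff (i j : Tup A (numbers k)) : IsNext i j ↔ index j = index i + 1 := by
  refine ⟨fun ⟨h1, h2⟩ => ?_, fun h => ⟨by omega, fun l hl => by omega⟩⟩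
  obtain ⟨l, hl⟩ := exists_index (A := A) (k := k) (i := index i + 1) (h1.trans_le (index_le j))
  have := h2 l (by omega)
  omega

/-- The set `p` of positions is the set of those bits of `x` that have a position. -/
def Represents (p : Tup A (numbers k) → Prop) (x : ℕ) : Prop :=
  ∀ l, p l ↔ x.testBit (index l) = true

variable {p q r : Tup A (numbers k) → Prop} {x y n : ℕ}

theorem Represents.lessBelow (hp : Represents p x) (hq : Represents q y)
    (i : Tup A (numbers k)) :
    LessBelow p q i ↔ x % 2 ^ index i < y % 2 ^ index i := by
  rw [testBit_mod_lt_iff]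
  constructor
  · rintro ⟨l, h1, h2, h3, h4⟩
    refine ⟨index l, h1, (hp l).not.1 h2, (hq l).1 h3, fun l' h5 h6 => ?_⟩
    obtain ⟨m, rfl⟩ := exists_index (A := A) (k := k) (h6.le.trans (index_le i))
    rw [← hp, ← hq]
    exact h4 m h5 h6
  · rintro ⟨l, h1, h2, h3, h4⟩
    obtain ⟨m, rfl⟩ := exists_index (A := A) (k := k) (h1.le.trans (index_le i))
    refine ⟨m, h1, (hp m).not.2 h2, (hq m).2 h3, fun l' h5 h6 => ?_⟩
    rw [hp, hq]
    exact h4 _ h5 h6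

/-- `Less` ignores the bit at the top position itself, which vanishes under the stated bounds. -/
theorem Represents.less (hp : Represents p x) (hq : Represents q y)
    (hx : x < 2 ^ maxIndex (Nat.card A) k) (hy : y < 2 ^ maxIndex (Nat.card A) k) :
    Less p q ↔ x < y := by
  simp only [Less, index_le_all_iff, hp.lessBelow hq]
  constructor
  · rintro ⟨t, ht, h⟩
    rwa [ht, Nat.mod_eq_of_lt hx, Nat.mod_eq_of_lt hy] at h
  · intro h
    obtain ⟨t, ht⟩ := exists_index (A := A) (k := k) le_rfl
    exact ⟨t, ht, by rwa [ht, Nat.mod_eq_of_lt hx, Nat.mod_eq_of_lt hy]⟩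

theorem Represents.doubleAdd (hr : Represents r n) (β : Bool) :
    Represents (DoubleAdd r (β = true)) (2 * n + β.toNat) := by
  intro i
  have h0 : (∀ l : Tup A (numbers k), index i ≤ index l) ↔ index i = 0 := by
    refine ⟨fun h => ?_, fun h l => h ▸ Nat.zero_le _⟩
    obtain ⟨l, hl⟩ := exists_index (A := A) (k := k) (Nat.zero_le _)
    exact Nat.le_zero.1 (hl ▸ h l)
  rw [testBit_two_mul_add, DoubleAdd, h0]
  simp only [isNext_iff]
  refine or_congr Iff.rfl ⟨fun ⟨i', h, h'⟩ => ⟨_, h, (hr i').1 h'⟩, fun ⟨i', h, h'⟩ => ?_⟩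
  obtain ⟨m, rfl⟩ := exists_index (A := A) (k := k) (i := i') (by have := index_le i; omega)
  exact ⟨m, h, (hr m).2 h'⟩

/-- Below `2 * y` the remainder needs at most one subtraction. -/
theorem Represents.reduce (hp : Represents p x) (hq : Represents q y)
    (hx : x < 2 * y) (hy : 2 * y ≤ 2 ^ maxIndex (Nat.card A) k) :
    Represents (Reduce p q) (x % y) := by
  intro i
  rw [Reduce, hp.less hq (by omega) (by omega), hp.lessBelow hq, mod_eq_ite hx, hp, hq]
  split_ifs with h
  · simp [h]
  · simp [h, testBit_sub_iff (not_lt.1 h)]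

end Bits

/-! ### Division of definable numbers -/

namespace Definable

variable {Δ : List (List Srt)} {Γ : List Srt} {k : ℕ}
  {p q : ∀ M : Model.{u} S, Env M.A Δ → Tup M.A Γ → Tup M.A (numbers k) → Prop}

theorem index_lt {f g : ∀ M : Model.{u} S, Tup M.A Γ → Tup M.A (numbers k)} (hf : IsBlock f)
    (hg : IsBlock g) : Definable fun M (_ : Env M.A Δ) v => index (f M v) < index (g M v) :=
  (index_le hg hf).not.congr fun _ _ _ => not_le.symm

theorem isNext {f g : ∀ M : Model.{u} S, Tup M.A Γ → Tup M.A (numbers k)} (hf : IsBlock f)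
    (hg : IsBlock g) : Definable fun M (_ : Env M.A Δ) v => IsNext (f M v) (g M v) :=
  (index_lt hf hg).and (all (T := numbers k)
    (Q := fun M _ l v => index (f M v) < index l → index (g M v) ≤ index l)
    ((index_lt (hf.comp IsBlock.id.snd) IsBlock.id.fst).imp
      (index_le (hg.comp IsBlock.id.snd) IsBlock.id.fst)))

theorem lessBelow (hp : Definable (Γ := numbers k ++ Γ) fun M X w => p M X (snd w) (fst w))
    (hq : Definable (Γ := numbers k ++ Γ) fun M X w => q M X (snd w) (fst w))
    {f : ∀ M : Model.{u} S, Tup M.A Γ → Tup M.A (numbers k)} (hf : IsBlock f) :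
    Definable fun M X v => LessBelow (p M X v) (q M X v) (f M v) :=
  ex (T := numbers k) (Q := fun M X l v => index l < index (f M v) ∧ ¬ p M X v l ∧ q M X v l ∧
      ∀ l' : Tup M.A (numbers k), index l < index l' → index l' < index (f M v) →
        (p M X v l' ↔ q M X v l'))
    ((index_lt IsBlock.id.fst (hf.comp IsBlock.id.snd)).and (hp.not.and (hq.and
      (all (T := numbers k) (Γ := numbers k ++ Γ) (Q := fun M X l' w =>
        index (fst w) < index l' → index l' < index (f M (snd w)) →
          (p M X (snd w) l' ↔ q M X (snd w) l'))
        (.imp (index_lt IsBlock.id.snd.fst IsBlock.id.fst) (.imp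
          (index_lt IsBlock.id.fst (hf.comp IsBlock.id.snd.snd)) (.iff
          (comp₂ (Q := fun M X l v => p M X v l) hp IsBlock.id.fst IsBlock.id.snd.snd)
          (comp₂ (Q := fun M X l v => q M X v l) hq IsBlock.id.fst IsBlock.id.snd.snd))))))))

theorem less (hp : Definable (Γ := numbers k ++ Γ) fun M X w => p M X (snd w) (fst w))
    (hq : Definable (Γ := numbers k ++ Γ) fun M X w => q M X (snd w) (fst w)) :
    Definable fun M X v => Less (p M X v) (q M X v) :=
  ex (T := numbers k) (Q := fun M X t v => (∀ l : Tup M.A (numbers k), index l ≤ index t) ∧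
      LessBelow (p M X v) (q M X v) t)
    ((all (T := numbers k) (Γ := numbers k ++ Γ) (Q := fun _ _ l w => index l ≤ index (fst w))
      (index_le IsBlock.id.fst IsBlock.id.snd.fst)).and
      (lessBelow (p := fun M X w => p M X (snd w)) (q := fun M X w => q M X (snd w))
        (comp₂ (Q := fun M X l v => p M X v l) hp IsBlock.id.fst IsBlock.id.snd.snd)
        (comp₂ (Q := fun M X l v => q M X v l) hq IsBlock.id.fst IsBlock.id.snd.snd)
        IsBlock.id.fst))

theorem doubleAdd (hp : Definable (Γ := numbers k ++ Γ) fun M X w => p M X (snd w) (fst w))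
    {β : ∀ M : Model.{u} S, Env M.A Δ → Tup M.A Γ → Prop} (hβ : Definable β)
    {f : ∀ M : Model.{u} S, Tup M.A Γ → Tup M.A (numbers k)} (hf : IsBlock f) :
    Definable fun M X v => DoubleAdd (p M X v) (β M X v) (f M v) :=
  ((all (T := numbers k) (Q := fun M _ l v => index (f M v) ≤ index l)
    (index_le (hf.comp IsBlock.id.snd) IsBlock.id.fst)).and hβ).or
  (ex (T := numbers k) (Q := fun M X i v => IsNext i (f M v) ∧ p M X v i)
    ((isNext IsBlock.id.fst (hf.comp IsBlock.id.snd)).and hp))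

theorem reduce (hp : Definable (Γ := numbers k ++ Γ) fun M X w => p M X (snd w) (fst w))
    (hq : Definable (Γ := numbers k ++ Γ) fun M X w => q M X (snd w) (fst w))
    {f : ∀ M : Model.{u} S, Tup M.A Γ → Tup M.A (numbers k)} (hf : IsBlock f) :
    Definable fun M X v => Reduce (p M X v) (q M X v) (f M v) :=
  have hp' := comp₂ (Q := fun M X l v => p M X v l) hp hf .id
  have hq' := comp₂ (Q := fun M X l v => q M X v l) hq hf .id
  ((less hp hq).and hp').or ((less hp hq).not.and ((hp'.iff hq').iff (lessBelow hp hq hf)))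

end Definable

/-- The operator whose fixed point consists of the remainders of the long division:
the row `j` consists of the bits of the remainder of `a / 2 ^ j`, flagged by a nonzero number, and
of all positions, flagged by zero. -/
def divisionStep {A : Type u} {k : ℕ} (a b : Tup A (numbers k) → Prop)
    (Y : Tup A (.number :: (numbers k ++ numbers k)) → Prop)
    (y : Tup A (.number :: (numbers k ++ numbers k))) : Prop :=
  ((∀ l : Tup A (numbers k), index l ≤ index (fst (tail y))) ∨
    ∃ j' : Tup A (numbers k), IsNext (fst (tail y)) j' ∧
      ∃ x : Dom A .number, Y (.cons x (append j' (snd (tail y))))) ∧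
  ((∀ x : Dom A .number, (head y).val ≤ x.val) ∨
    Reduce (DoubleAdd (fun i => ∃ j' : Tup A (numbers k), IsNext (fst (tail y)) j' ∧
      ∃ x : Dom A .number, (¬ ∀ x' : Dom A .number, x.val ≤ x'.val) ∧ Y (.cons x (append j' i)))
      (a (fst (tail y)))) b (snd (tail y)))

section Division

variable {A : Type u} {k : ℕ}

/-- After `s` stages exactly the rows of the `s` highest indices are present, each complete and
final. A row is entered only once its predecessor is known, so the inflationary fixed point never
keeps a wrong bit. -/
theorem stage_divisionStep [Finite A] [Nonempty A] {p q : Tup A (numbers k) → Prop} {a b : ℕ}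
    (hp : Represents p a) (hq : Represents q b) (ha : a < 2 ^ maxIndex (Nat.card A) k)
    (hb : 0 < b) (hb' : 2 * b ≤ 2 ^ maxIndex (Nat.card A) k) (s : ℕ)
    (x : Dom A .number) (j i : Tup A (numbers k)) :
    stage (divisionStep p q) s (.cons x (append j i)) ↔
      maxIndex (Nat.card A) k < index j + s ∧
        (x.val = 0 ∨ (a / 2 ^ index j % b).testBit (index i) = true) := by
  induction s generalizing x j i with
  | zero =>
    have := index_le j
    simp only [stage, false_iff]
    omega
  | succ s ih =>
    have hne : ∃ x : Dom A .number, x.val ≠ 0 := by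
      obtain ⟨x, hx⟩ := Dom.exists_val (A := A) le_rfl
      exact ⟨x, hx ▸ Nat.card_pos.ne'⟩
    have hj := index_le j
    have hrow : maxIndex (Nat.card A) k < index j + (s + 1) →
        Represents (fun i => ∃ j' : Tup A (numbers k), IsNext j j' ∧
          ∃ x : Dom A .number, (¬ ∀ x' : Dom A .number, x.val ≤ x'.val) ∧
            stage (divisionStep p q) s (.cons x (append j' i))) (a / 2 ^ (index j + 1) % b) := by
      intro hs i
      simp only [ih, Dom.le_forall_val_iff, isNext_iff]
      constructor
      · rintro ⟨j', hj', x, hx, -, h | h⟩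
        · exact (hx h).elim
        · rwa [hj'] at h
      · intro h
        by_cases htop : index j = maxIndex (Nat.card A) k
        · rw [Nat.div_eq_of_lt (ha.trans_le (Nat.pow_le_pow_right two_pos (by omega)))] at h
          simp at h
        · obtain ⟨j', hj'⟩ := exists_index (A := A) (k := k) (i := index j + 1) (by omega)
          obtain ⟨x, hx⟩ := hne
          exact ⟨j', hj', x, hx, by omega, .inr (hj' ▸ h)⟩
    have hstep : divisionStep p q (stage (divisionStep p q) s) (.cons x (append j i)) ↔
        maxIndex (Nat.card A) k < index j + (s + 1) ∧
          (x.val = 0 ∨ (a / 2 ^ index j % b).testBit (index i) = true) := by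
      rw [divisionStep]
      simp only [head_cons, tail_cons, fst_append, snd_append]
      rw [Dom.le_forall_val_iff, index_le_all_iff]
      have hguard : (index j = maxIndex (Nat.card A) k ∨ ∃ j' : Tup A (numbers k), IsNext j j' ∧
          ∃ x : Dom A .number, stage (divisionStep p q) s (.cons x (append j' i))) ↔
          maxIndex (Nat.card A) k < index j + (s + 1) := by
        simp only [ih, isNext_iff]
        constructor
        · rintro (h | ⟨j', hj', x, h, -⟩) <;> omega
        · intro h
          by_cases htop : index j = maxIndex (Nat.card A) k
          · exact .inl htop
          · obtain ⟨j', hj'⟩ := exists_index (A := A) (k := k) (i := index j + 1) (by omega)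
            -- An entry flagged by zero shows that the row has been computed even if its remainder
            -- is 0 and has no bits.
            obtain ⟨x, hx⟩ := Dom.exists_val (A := A) (Nat.zero_le _)
            exact .inr ⟨j', hj', x, by omega, .inl hx⟩
      rw [hguard]
      refine and_congr_right fun hs => or_congr Iff.rfl ?_
      have hr := Nat.mod_lt (a / 2 ^ (index j + 1)) hb
      have hβ := Bool.toNat_le (a.testBit (index j))
      rw [div_two_pow_mod, hp j]
      exact ((hrow hs).doubleAdd _).reduce hq (by omega) hb' i
    simp only [stage, hstep, ih]
    constructor
    · rintro (h | h)
      · exact ⟨by omega, h.2⟩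
      · exact h
    · exact .inr

end Division

/-- Here the fixed-point relation is the only relation variable: `p` and `q` depend on the structure
alone and are weakened by it. -/
theorem Definable.divisionStep {k : ℕ} {p q : ∀ M : Model.{u} S, Tup M.A (numbers k) → Prop}
    (hp : Definable (Δ := []) fun M _ v => p M v) (hq : Definable (Δ := []) fun M _ v => q M v)
    {Γ : List Srt} :
    Definable (Δ := [.number :: (numbers k ++ numbers k)])
      (Γ := .number :: (numbers k ++ numbers k) ++ Γ)
      fun M X w => FPOrd.divisionStep (p M) (q M) (head X)
        (fst (l := .number :: (numbers k ++ numbers k)) w) := by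
  let T := Srt.number :: (numbers k ++ numbers k)
  have hX : ∀ {Γ' : List Srt} {f : ∀ M : Model.{u} S, Tup M.A Γ' → Tup M.A T} (_ : IsBlock f),
      Definable (Δ := [T]) fun M X v => head X (f M v) := fun {Γ' f} hf =>
    (rvar (Idx.zero (a := T) (l := [])) hf).congr fun M X v => by cases X; rfl
  have hp' : ∀ {Γ' : List Srt} {f : ∀ M : Model.{u} S, Tup M.A Γ' → Tup M.A (numbers k)}
      (_ : IsBlock f), Definable (Δ := [T]) fun M _ v => p M (f M v) := fun hf =>
    (hp.weaken (T := T)).comp hf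
  have hq' : ∀ {Γ' : List Srt} {f : ∀ M : Model.{u} S, Tup M.A Γ' → Tup M.A (numbers k)}
      (_ : IsBlock f), Definable (Δ := [T]) fun M _ v => q M (f M v) := fun hf =>
    (hq.weaken (T := T)).comp hf
  have hzero : ∀ {Γ' : List Srt} {f : ∀ M : Model.{u} S, Tup M.A Γ' → Dom M.A .number}
      (_ : IsVar fun M w => f M (tail (a := .number) w)),
      Definable (Δ := [T]) fun M _ v => ∀ x : Dom M.A .number, (f M v).val ≤ x.val :=
    fun {_ f} hf => all_one (Q := fun M _ x v => (f M v).val ≤ x.val) (le hf (.head .id))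
  have hy : IsBlock fun (M : Model.{u} S) (w : Tup M.A (T ++ Γ)) => fst (l := T) w :=
    IsBlock.fst (T := T) .id
  have hj := hy.tail.fst
  have hi := hy.tail.snd
  refine .and (.or (all (T := numbers k)
      (Q := fun M _ l (w : Tup M.A (T ++ Γ)) => index l ≤ index (fst (tail (fst (l := T) w))))
      (index_le IsBlock.id.fst (hj.comp IsBlock.id.snd)))
    (ex (T := numbers k) (Q := fun M X j' (w : Tup M.A (T ++ Γ)) =>
      IsNext (fst (tail (fst (l := T) w))) j' ∧ ∃ x : Dom M.A .number,
        head X (.cons x (append j' (snd (tail (fst (l := T) w))))))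
      (.and (isNext (hj.comp IsBlock.id.snd) IsBlock.id.fst)
        (ex_one (Q := fun M X x (w : Tup M.A (numbers k ++ (T ++ Γ))) =>
          head X (.cons x (append (fst w) (snd (tail (fst (l := T) (snd w)))))))
          (hX (.cons (.head .id) (.append IsBlock.id.tail.fst (hi.comp IsBlock.id.tail.snd))))))))
    (.or (hzero (.head (T := numbers k ++ numbers k) (hy.comp IsBlock.id.tail))) ?_)
  refine reduce (p := fun M X (w : Tup M.A (T ++ Γ)) => DoubleAdd (fun i =>
    ∃ j' : Tup M.A (numbers k), IsNext (fst (tail (fst (l := T) w))) j' ∧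
      ∃ x : Dom M.A .number, (¬ ∀ x' : Dom M.A .number, x.val ≤ x'.val) ∧
        head X (.cons x (append j' i))) (p M (fst (tail (fst (l := T) w)))))
    (q := fun M X w => q M) ?_ (hq' IsBlock.id.fst) hi
  refine doubleAdd (p := fun M X (w : Tup M.A (numbers k ++ (T ++ Γ))) i =>
    ∃ j' : Tup M.A (numbers k), IsNext (fst (tail (fst (l := T) (snd w)))) j' ∧
      ∃ x : Dom M.A .number, (¬ ∀ x' : Dom M.A .number, x.val ≤ x'.val) ∧
        head X (.cons x (append j' i))) ?_ (hp' (hj.comp IsBlock.id.snd)) IsBlock.id.fst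
  refine ex (T := numbers k)
    (Q := fun M X j' (w : Tup M.A (numbers k ++ (numbers k ++ (T ++ Γ)))) =>
    IsNext (fst (tail (fst (l := T) (snd (snd w))))) j' ∧
      ∃ x : Dom M.A .number, (¬ ∀ x' : Dom M.A .number, x.val ≤ x'.val) ∧
        head X (.cons x (append j' (fst w))))
    (.and (isNext (hj.comp IsBlock.id.snd.snd.snd) IsBlock.id.fst) ?_)
  exact ex_one
    (Q := fun M X x (w : Tup M.A (numbers k ++ (numbers k ++ (numbers k ++ (T ++ Γ))))) =>
    (¬ ∀ x' : Dom M.A .number, x.val ≤ x'.val) ∧ head X (.cons x (append (fst w) (fst (snd w)))))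
    (.and (hzero (.head IsBlock.id.tail)).not
      (hX (.cons (.head .id) (.append IsBlock.id.tail.fst IsBlock.id.tail.snd.fst))))

/-- Quotients of definable numbers are definable. -/
theorem Definable.testBit_div {k : ℕ} {a b : Model.{u} S → ℕ}
    (hp : Definable (Δ := []) (Γ := numbers k) fun M _ v => (a M).testBit (index v) = true)
    (hq : Definable (Δ := []) (Γ := numbers k) fun M _ v => (b M).testBit (index v) = true)
    (ha : ∀ M, a M < 2 ^ maxIndex (Nat.card M.A) k) (hb : ∀ M, 0 < b M)
    (hb' : ∀ M, 2 * b M ≤ 2 ^ maxIndex (Nat.card M.A) k) :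
    Definable (Δ := []) (Γ := numbers k) fun M _ v => (a M / b M).testBit (index v) = true := by
  let T := Srt.number :: (numbers k ++ numbers k)
  let p (M : Model.{u} S) (l : Tup M.A (numbers k)) : Prop := (a M).testBit (index l) = true
  let q (M : Model.{u} S) (l : Tup M.A (numbers k)) : Prop := (b M).testBit (index l) = true
  let R (M : Model.{u} S) (y : Tup M.A T) : Prop :=
    ∃ n, stage (FPOrd.divisionStep (p M) (q M)) n y
  have hR : Definable (Δ := []) fun M _ y => R M y :=
    ifp (F := fun M _ Y y _ => FPOrd.divisionStep (p M) (q M) Y y) (divisionStep hp hq) .id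
  have hrow : Definable (Δ := []) (Γ := numbers k ++ numbers k) fun M _ w =>
      ∃ j' : Tup M.A (numbers k), IsNext (snd w) j' ∧
      ∃ x : Dom M.A .number, (¬ ∀ x' : Dom M.A .number, x.val ≤ x'.val) ∧
        R M (.cons x (append j' (fst w))) := by
    refine ex (T := numbers k) (Q := fun M _ j' (w : Tup M.A (numbers k ++ numbers k)) =>
      IsNext (snd w) j' ∧ ∃ x : Dom M.A .number, (¬ ∀ x' : Dom M.A .number, x.val ≤ x'.val) ∧
        R M (.cons x (append j' (fst w))))
      (.and (isNext IsBlock.id.snd.snd IsBlock.id.fst) ?_)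
    exact ex_one (Q := fun M _ x (w : Tup M.A (numbers k ++ (numbers k ++ numbers k))) =>
      (¬ ∀ x' : Dom M.A .number, x.val ≤ x'.val) ∧ R M (.cons x (append (fst w) (fst (snd w)))))
      (.and (not (all_one (Q := fun M _ x' w => (head w).val ≤ x'.val)
        (le (.head IsBlock.id.tail) (.head .id))))
        (hR.comp (.cons (.head .id) (.append IsBlock.id.tail.fst IsBlock.id.tail.snd.fst))))
  -- Quotient bits are first-order in the table of remainders, by `testBit_div_iff`.
  refine (not (less (p := fun M _ (v : Tup M.A (numbers k)) => DoubleAdd (fun i =>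
      ∃ j' : Tup M.A (numbers k), IsNext v j' ∧
      ∃ x : Dom M.A .number, (¬ ∀ x' : Dom M.A .number, x.val ≤ x'.val) ∧
        R M (.cons x (append j' i))) (p M v)) (q := fun M _ _ => q M)
    (doubleAdd (p := fun M _ (w : Tup M.A (numbers k ++ numbers k)) i =>
      ∃ j' : Tup M.A (numbers k), IsNext (snd w) j' ∧
      ∃ x : Dom M.A .number, (¬ ∀ x' : Dom M.A .number, x.val ≤ x'.val) ∧
        R M (.cons x (append j' i)))
      (hrow.comp (IsBlock.append IsBlock.id.fst IsBlock.id.snd.snd) |>.congr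
        fun M X v => by simp only [fst_append, snd_append])
      (hp.comp IsBlock.id.snd) IsBlock.id.fst)
    (hq.comp IsBlock.id.fst))).congr fun M X j => ?_
  have hRiff : ∀ x (j i : Tup M.A (numbers k)), R M (.cons x (append j i)) ↔
      (x.val = 0 ∨ (a M / 2 ^ index j % b M).testBit (index i) = true) := by
    intro x j i
    have h := fun s => stage_divisionStep (p := p M) (q := q M) (fun _ => Iff.rfl)
      (fun _ => Iff.rfl) (ha M) (hb M) (hb' M) s x j i
    -- One stage for each index from 0 to `maxIndex` fills the whole table.
    exact ⟨fun ⟨s, hs⟩ => ((h s).1 hs).2, fun h' => ⟨_, (h (maxIndex (Nat.card M.A) k + 1)).2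
      ⟨by omega, h'⟩⟩⟩
  have hrow' : Represents (fun i => ∃ j' : Tup M.A (numbers k), IsNext j j' ∧
      ∃ x : Dom M.A .number, (¬ ∀ x' : Dom M.A .number, x.val ≤ x'.val) ∧
        R M (.cons x (append j' i))) (a M / 2 ^ (index j + 1) % b M) := by
    intro i
    simp only [hRiff, Dom.le_forall_val_iff, isNext_iff]
    constructor
    · rintro ⟨j', hj', x, hx, h | h⟩
      · exact (hx h).elim
      · rwa [hj'] at h
    · intro h
      by_cases htop : maxIndex (Nat.card M.A) k < index j + 1
      · rw [Nat.div_eq_of_lt ((ha M).trans_le (Nat.pow_le_pow_right two_pos htop.le))] at h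
        simp at h
      · obtain ⟨j', hj'⟩ := exists_index (A := M.A) (k := k) (i := index j + 1) (by omega)
        obtain ⟨x, hx⟩ := Dom.exists_val (A := M.A) le_rfl
        exact ⟨j', hj', x, hx ▸ Nat.card_pos.ne', .inr (hj' ▸ h)⟩
  have hr := Nat.mod_lt (a M / 2 ^ (index j + 1)) (hb M)
  have hβ := Bool.toNat_le ((a M).testBit (index j))
  have := hb' M
  rw [testBit_div_iff _ _ (hb M)]
  refine not_congr (Iff.symm ?_)
  exact (hrow'.doubleAdd _).less (q := q M) (fun _ => Iff.rfl) (by omega) (by omega)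

/-! ### Orders of definable groups -/

section Padding

variable {A : Type u}

/-- Permutations of `A ^ T` act on the second component of `A ^ (U ++ T)`. -/
def padHom (U T : List Srt) : Equiv.Perm (Tup A T) →* Equiv.Perm (Tup A (U ++ T)) where
  toFun σ := ⟨fun w => append (fst w) (σ (snd w)), fun w => append (fst w) (σ.symm (snd w)),
    fun w => by simp, fun w => by simp⟩
  map_one' := Equiv.ext fun w => append_fst_snd w
  map_mul' σ τ := Equiv.ext fun w => by simp

theorem padHom_apply {U T : List Srt} (σ : Equiv.Perm (Tup A T)) (w : Tup A (U ++ T)) :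
    padHom U T σ w = append (fst w) (σ (snd w)) := rfl

theorem padHom_injective [Nonempty A] (U T : List Srt) :
    Function.Injective (padHom (A := A) U T) := by
  intro σ τ h
  obtain ⟨u⟩ : Nonempty (Tup A U) := inferInstance
  refine Equiv.ext fun b => ?_
  have := congrArg (fun f : Equiv.Perm (Tup A (U ++ T)) => snd (f (append u b))) h
  simpa [padHom_apply] using this

theorem eq_append_iff {U T : List Srt} (u : Tup A U) (b : Tup A T) (w : Tup A (U ++ T)) :
    append u b = w ↔ u = fst w ∧ b = snd w := by
  rw [← append_inj, append_fst_snd]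

/-- Raises the arity of the numerical relation that `ord` produces without changing the group order.
The relation does not mention the value of the first component, so its action on the second is the
same for every such value, and any fixed `u` recovers it. -/
theorem card_spanGroup_pad [Finite A] [Nonempty A] {P T : List Srt} (U : List Srt)
    (Φ : Tup A P → Tup A T → Tup A T → Prop) :
    Nat.card (spanGroup fun a (b c : Tup A (U ++ T)) => fst b = fst c ∧ Φ a (snd b) (snd c)) =
      Nat.card (spanGroup Φ) := by
  suffices h : (spanGroup fun a (b c : Tup A (U ++ T)) =>
      fst b = fst c ∧ Φ a (snd b) (snd c)) = (spanGroup Φ).map (padHom U T) by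
    rw [h]
    exact (Nat.card_congr ((spanGroup Φ).equivMapOfInjective _ (padHom_injective U T)).toEquiv).symm
  rw [spanGroup, spanGroup, MonoidHom.map_closure]
  congr 1
  ext σ'
  constructor
  · rintro ⟨a, h⟩
    obtain ⟨u⟩ : Nonempty (Tup A U) := inferInstance
    have hfst : ∀ w, fst (σ' w) = fst w := fun w => ((h w _).2 rfl).1.symm
    have hinj : Function.Injective fun b : Tup A T => snd (σ' (append u b)) := by
      intro b b' hb
      have : σ' (append u b) = σ' (append u b') := by
        rw [← append_fst_snd (σ' (append u b)), ← append_fst_snd (σ' (append u b')), hfst, hfst,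
          fst_append, fst_append]
        exact congrArg _ hb
      exact (append_inj.1 (σ'.injective this)).2
    let σ : Equiv.Perm (Tup A T) := Equiv.ofBijective _ (Finite.injective_iff_bijective.1 hinj)
    have hσ : ∀ b c, Φ a b c ↔ σ b = c := by
      intro b c
      have := h (append u b) (append u c)
      simp only [fst_append, snd_append, true_and] at this
      rw [this, ← append_fst_snd (σ' (append u b)), append_inj, hfst, fst_append]
      simp [σ]
    refine ⟨σ, ⟨a, hσ⟩, Equiv.ext fun w => ((h w _).1 ?_).symm⟩
    rw [padHom_apply, fst_append, snd_append]
    exact ⟨rfl, (hσ _ _).2 rfl⟩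
  · rintro ⟨σ, ⟨a, h⟩, rfl⟩
    exact ⟨a, fun b c => by rw [padHom_apply, eq_append_iff, h]⟩

/-- With N = |A^T| ≤ (2|A|)^l, the order is at most N! ≤ 2^(N²), and N² + 1 ≤ 2(4^l + 1)|A|^(2l).
The factor 2 leaves room for the doubled remainders of the division. -/
theorem two_mul_card_subgroup_le [Finite A] [Nonempty A] {T : List Srt} {l : ℕ}
    (hl : T.length ≤ l) (G : Subgroup (Equiv.Perm (Tup A T))) :
    2 * Nat.card G ≤ 2 ^ maxIndex (Nat.card A) (2 * l + 2 * (4 ^ l + 1)) := by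
  have hn : 0 < Nat.card A := Nat.card_pos
  have hx : Nat.card (Tup A T) ≤ (2 * Nat.card A) ^ l :=
    (card_tup_le T).trans ((Nat.pow_le_pow_right (Nat.succ_pos _) hl).trans
      (Nat.pow_le_pow_left (by omega) l))
  have hG : Nat.card G ≤ (Nat.card (Tup A T)).factorial :=
    (Nat.card_le_card_of_injective _ Subtype.val_injective).trans_eq Nat.card_perm
  have hpow : (Nat.card (Tup A T)).factorial ≤ 2 ^ (Nat.card (Tup A T) * Nat.card (Tup A T)) := by
    rw [pow_mul]
    exact (Nat.factorial_le_pow _).trans (Nat.pow_le_pow_left Nat.lt_two_pow_self.le _)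
  have hsq : Nat.card (Tup A T) * Nat.card (Tup A T) + 1 ≤
      2 * (4 ^ l + 1) * Nat.card A ^ (2 * l) := by
    have h1 : Nat.card (Tup A T) * Nat.card (Tup A T) ≤ 4 ^ l * Nat.card A ^ (2 * l) := by
      refine (Nat.mul_le_mul hx hx).trans_eq ?_
      rw [← mul_pow, pow_mul, ← mul_pow]
      ring
    have h2 : 0 < Nat.card A ^ (2 * l) := Nat.pow_pos hn
    generalize Nat.card A ^ (2 * l) = y at *
    generalize 4 ^ l = c at *
    nlinarith
  calc 2 * Nat.card G ≤ 2 ^ (Nat.card (Tup A T) * Nat.card (Tup A T) + 1) := by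
        rw [pow_succ, mul_comm]
        exact Nat.mul_le_mul_right _ (hG.trans hpow)
    _ ≤ _ := Nat.pow_le_pow_right two_pos (hsq.trans (mul_pow_le_maxIndex hn _ _))

end Padding

namespace Definable

variable {Δ : List (List Srt)} {Γ P T : List Srt}

/-- The bits of the order of a definable group, at positions of sufficiently large even arity. -/
theorem testBit_card_spanGroup {k c : ℕ} (hk : k = 2 * (c + T.length))
    {Φ : ∀ M : Model.{u} S, Env M.A Δ → Tup M.A P → Tup M.A T → Tup M.A T → Prop}
    (hΦ : Definable (Γ := P ++ (T ++ T)) fun M X w =>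
      Φ M X (fst w) (fst (snd w)) (snd (snd w))) :
    Definable (Γ := numbers k) fun M X v =>
      (Nat.card (spanGroup (Φ M X))).testBit (index v) = true := by
  obtain rfl : k = 2 * (numbers c ++ T).length := by simp [hk]
  refine (ord (T := numbers c ++ T)
    (Φ := fun M X a b c _ => fst b = fst c ∧ Φ M X a (snd b) (snd c))
    (.and (eq IsBlock.id.snd.fst.fst IsBlock.id.snd.snd.fst.fst)
      (comp₃ hΦ IsBlock.id.fst IsBlock.id.snd.fst.snd IsBlock.id.snd.snd.fst.snd)) .id).congr
    fun M X v => ?_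
  rw [card_spanGroup_pad]

/-- Leading zeros do not change the position. -/
theorem testBit_of_add {a : Model.{u} S → ℕ} {j : ℕ} : ∀ {d : ℕ}
    (_ : Definable (Δ := Δ) (Γ := numbers (j + d)) fun M _ v => (a M).testBit (index v) = true),
    Definable (Δ := Δ) (Γ := numbers j) fun M _ v => (a M).testBit (index v) = true
  | 0, h => h
  | d + 1, h => by
    refine testBit_of_add (d := d) ((ex_one (a := .number)
      (Γ := numbers (j + d)) (Q := fun M _ y v =>
      (∀ x : Dom M.A .number, y.val ≤ x.val) ∧
        (a M).testBit (index (k := j + d + 1) (.cons y v)) = true)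
      (.and (all_one (Q := fun M _ x (w : Tup M.A (numbers (j + d + 1))) =>
          (head (l := numbers (j + d)) w).val ≤ x.val)
        (le (.head (T := numbers (j + d)) IsBlock.id.tail) (.head .id)))
      (h.comp (f := fun M w => .cons (head w) (tail w)) (.cons (.head .id) IsBlock.id.tail)))).congr
      fun M X v => ?_)
    obtain ⟨y, hy⟩ := Dom.exists_val (A := M.A) (Nat.zero_le _)
    have hindex : ∀ x : Dom M.A .number, x.val = 0 →
        index (k := j + d + 1) (.cons x v) = index v := fun x hx => by
      rw [index_cons, hx, mul_zero, zero_add]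
    constructor
    · exact fun h => ⟨y, fun x => hy ▸ Nat.zero_le _, by rwa [hindex y hy]⟩
    · rintro ⟨x, hx, h⟩
      rwa [hindex x (Nat.le_zero.1 (hy ▸ hx y))] at h

end Definable

/-- The binary relation `R` is the graph of a permutation (of a finite set). -/
def IsPermGraph {β : Type u} (R : β → β → Prop) : Prop :=
  (∀ b, ∃ c, R b c) ∧ (∀ b c c', R b c → R b c' → c = c') ∧ ∀ b b' c, R b c → R b' c → b = b'

/-- On a finite set surjectivity is automatic, so it is not part of `IsPermGraph`. -/
theorem isPermGraph_iff {β : Type u} [Finite β] (R : β → β → Prop) :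
    IsPermGraph R ↔ ∃ σ : Equiv.Perm β, ∀ b c, R b c ↔ σ b = c := by
  constructor
  · rintro ⟨h1, h2, h3⟩
    choose f hf using h1
    have hinj : f.Injective := fun b b' h => h3 b b' _ (hf b) (h ▸ hf b')
    exact ⟨Equiv.ofBijective f (Finite.injective_iff_bijective.1 hinj), fun b c =>
      ⟨fun h => h2 b _ _ (hf b) h, fun h => h ▸ hf b⟩⟩
  · rintro ⟨σ, h⟩
    simp only [IsPermGraph, h]
    exact ⟨fun b => ⟨_, rfl⟩, fun b c c' h h' => h.symm.trans h',
      fun b b' c h h' => σ.injective (h.trans h'.symm)⟩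

theorem Definable.isPermGraph {Δ : List (List Srt)} {Γ T : List Srt}
    {R : ∀ M : Model.{u} S, Env M.A Δ → Tup M.A T → Tup M.A T → Tup M.A Γ → Prop}
    (hR : Definable (Γ := T ++ (T ++ Γ)) fun M X w =>
      R M X (fst w) (fst (snd w)) (snd (snd w))) :
    Definable fun M X v => IsPermGraph fun b c => R M X b c v := by
  refine .and (all (T := T) (Q := fun M X b v => ∃ c, R M X b c v)
    (ex (T := T) (Γ := T ++ Γ) (Q := fun M X c w => R M X (fst w) c (snd w))
      (comp₃ (Q := fun M X b c v => R M X b c v) hR IsBlock.id.snd.fst IsBlock.id.fst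
        IsBlock.id.snd.snd))) (.and ?_ ?_)
  · exact all (T := T) (Q := fun M X b v => ∀ c c', R M X b c v → R M X b c' v → c = c')
      (all (T := T) (Γ := T ++ Γ) (Q := fun M X c w => ∀ c', R M X (fst w) c (snd w) →
        R M X (fst w) c' (snd w) → c = c')
      (all (T := T) (Γ := T ++ (T ++ Γ)) (Q := fun M X c' w =>
        R M X (fst (snd w)) (fst w) (snd (snd w)) → R M X (fst (snd w)) c' (snd (snd w)) → fst w = c')
      (.imp (comp₃ (Q := fun M X b c v => R M X b c v) hR IsBlock.id.snd.snd.fst IsBlock.id.snd.fst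
        IsBlock.id.snd.snd.snd) (.imp (comp₃ (Q := fun M X b c v => R M X b c v) hR
        IsBlock.id.snd.snd.fst IsBlock.id.fst IsBlock.id.snd.snd.snd)
        (eq IsBlock.id.snd.fst IsBlock.id.fst)))))
  · exact all (T := T) (Q := fun M X b v => ∀ b' c, R M X b c v → R M X b' c v → b = b')
      (all (T := T) (Γ := T ++ Γ) (Q := fun M X b' w => ∀ c, R M X (fst w) c (snd w) →
        R M X b' c (snd w) → fst w = b')
      (all (T := T) (Γ := T ++ (T ++ Γ)) (Q := fun M X c w => R M X (fst (snd w)) c (snd (snd w)) →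
        R M X (fst w) c (snd (snd w)) → fst (snd w) = fst w)
      (.imp (comp₃ (Q := fun M X b c v => R M X b c v) hR IsBlock.id.snd.snd.fst IsBlock.id.fst
        IsBlock.id.snd.snd.snd) (.imp (comp₃ (Q := fun M X b c v => R M X b c v) hR
        IsBlock.id.snd.fst IsBlock.id.fst IsBlock.id.snd.snd.snd)
        (eq IsBlock.id.snd.snd.fst IsBlock.id.snd.fst)))))

/-! ### Kernels and images of definable morphisms -/

section Morphism

variable {A : Type u} {P T T' : List Srt}

theorem graph_append (σ : Equiv.Perm (Tup A T)) (b c : Tup A T) :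
    graph σ (append b c) ↔ σ b = c := by
  constructor
  · rintro ⟨a, h⟩
    obtain ⟨rfl, rfl⟩ := append_inj.1 h
    rfl
  · rintro rfl
    exact ⟨b, rfl⟩

/-- The images of the generators that `φG` defines, under the morphism that `φm` defines. -/
def imageRel (𝔄 : Str S A) (φG : Formula S [] (P ++ (T ++ T)))
    (φm : Formula S [T ++ T] (T' ++ T')) (p : Tup A P) (x y : Tup A T') : Prop :=
  (IsPermGraph fun b c => φG.Holds 𝔄 .nil (append p (append b c))) ∧
    φm.Holds 𝔄 (.cons (fun w => φG.Holds 𝔄 .nil (append p w)) .nil) (append x y)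

/-- The generators that `φG` defines, and the permutation with graph `R`. -/
def adjoinRel (𝔄 : Str S A) (φG : Formula S [] (P ++ (T ++ T))) (R : Tup A (T ++ T) → Prop)
    (p : Tup A (.number :: P)) (b c : Tup A T) : Prop :=
  (∀ x : Dom A .number, (head p).val ≤ x.val) ∧ φG.Holds 𝔄 .nil (append (tail p) (append b c)) ∨
    (¬ ∀ x : Dom A .number, (head p).val ≤ x.val) ∧ R (append b c)

/-- A morphism maps generators to generators of the image. The test `IsPermGraph` in `imageRel` is
essential: on relations that are not graphs of elements of G nothing is known about `φm`, and it
might define stray permutations. -/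
theorem spanGroup_imageRel [Finite A] [Nonempty A] {𝔄 : Str S A} {φG : Formula S [] (P ++ (T ++ T))}
    {φm : Formula S [T ++ T] (T' ++ T')} {m : generated 𝔄 φG →* Equiv.Perm (Tup A T')}
    (hm : DefinesMorphism 𝔄 φm m) : spanGroup (imageRel 𝔄 φG φm) = m.range := by
  -- The generators, viewed inside G, generate all of G, so `m` can be moved through the closure.
  have htop : Subgroup.closure ((Subtype.val : generated 𝔄 φG → Equiv.Perm (Tup A T)) ⁻¹'
      {σ | ∃ p : Tup A P, ∀ b c, φG.Holds 𝔄 .nil (append p (append b c)) ↔ σ b = c}) = ⊤ :=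
    Subgroup.closure_closure_coe_preimage
  have hrel : ∀ (p : Tup A P) (σ : generated 𝔄 φG),
      (∀ b c, φG.Holds 𝔄 .nil (append p (append b c)) ↔ σ.1 b = c) →
      ∀ x y, imageRel 𝔄 φG φm p x y ↔ m σ x = y := by
    intro p σ hσ x y
    have hgraph : (fun w => φG.Holds 𝔄 .nil (append p w)) = graph σ.1 := by
      funext w
      rw [← append_fst_snd w, hσ, graph_append]
    rw [imageRel, isPermGraph_iff, hgraph, hm, graph_append]
    exact and_iff_right ⟨σ.1, hσ⟩
  rw [MonoidHom.range_eq_map, ← htop, MonoidHom.map_closure, spanGroup]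
  congr 1
  ext σ'
  constructor
  · rintro ⟨p, h⟩
    obtain ⟨x⟩ : Nonempty (Tup A T') := inferInstance
    obtain ⟨σ, hσ⟩ := (isPermGraph_iff _).1 ((h x _).2 rfl).1
    have hG : σ ∈ generated 𝔄 φG := Subgroup.subset_closure ⟨p, hσ⟩
    exact ⟨⟨σ, hG⟩, ⟨p, hσ⟩, Equiv.ext fun x => (hrel p ⟨σ, hG⟩ hσ x _).1 ((h x _).2 rfl)⟩
  · rintro ⟨σ, ⟨p, hσ⟩, rfl⟩
    exact ⟨p, hrel p σ hσ⟩

/-- The extra number parameter is a switch: zero selects the old generators, any other number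
selects `τ`. -/
theorem spanGroup_adjoinRel [Finite A] [Nonempty A] (𝔄 : Str S A)
    (φG : Formula S [] (P ++ (T ++ T))) (τ : Equiv.Perm (Tup A T)) :
    spanGroup (adjoinRel 𝔄 φG (graph τ)) = generated 𝔄 φG ⊔ Subgroup.zpowers τ := by
  rw [generated, spanGroup, spanGroup, Subgroup.zpowers_eq_closure, ← Subgroup.closure_union]
  congr 1
  obtain ⟨y, hy⟩ := Dom.exists_val (A := A) (Nat.zero_le _)
  obtain ⟨t, ht⟩ := Dom.exists_val (A := A) le_rfl
  have hpos : 0 < Nat.card A := Nat.card_pos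
  have hy' : ∀ x : Dom A .number, y.val ≤ x.val := fun x => hy ▸ Nat.zero_le _
  have ht' : ¬ ∀ x : Dom A .number, t.val ≤ x.val := fun h => by
    have := h y
    omega
  ext σ
  constructor
  · rintro ⟨p, h⟩
    by_cases hp : ∀ x : Dom A .number, (head p).val ≤ x.val
    · refine .inl ⟨tail p, fun b c => ?_⟩
      rw [← h, adjoinRel]
      tauto
    · refine .inr (Equiv.ext fun b => ?_)
      have := (h b _).2 rfl
      rw [adjoinRel, graph_append] at this
      exact (this.resolve_left fun h => hp h.1).2.symm
  · rintro (⟨p, h⟩ | rfl)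
    · exact ⟨.cons y p, fun b c => by simp [adjoinRel, h, hy']⟩
    · obtain ⟨p⟩ : Nonempty (Tup A P) := inferInstance
      exact ⟨.cons t p, fun b c => by
        rw [adjoinRel, graph_append, head_cons]
        exact ⟨fun h => (h.resolve_left fun h => ht' h.1).2, fun h => .inr ⟨ht', h⟩⟩⟩

theorem card_ker_eq_div [Finite A] {𝔄 : Str S A} {φG : Formula S [] (P ++ (T ++ T))}
    (m : generated 𝔄 φG →* Equiv.Perm (Tup A T')) :
    Nat.card m.ker = Nat.card (generated 𝔄 φG) / Nat.card m.range := by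
  rw [← Subgroup.index_ker, ← Subgroup.card_mul_index m.ker]
  exact (Nat.mul_div_cancel _ (Nat.pos_of_ne_zero Subgroup.FiniteIndex.index_ne_zero)).symm

end Morphism

theorem Definable.imageRel {P T T' : List Srt} (φG : Formula S [] (P ++ (T ++ T)))
    (φm : Formula S [T ++ T] (T' ++ T')) :
    Definable (Δ := []) (Γ := P ++ (T' ++ T')) fun (M : Model.{u} S) _ w =>
      FPOrd.imageRel M.str φG φm (fst w) (fst (snd w)) (snd (snd w)) := by
  have hG : Definable (Δ := []) fun (M : Model.{u} S) _ w => φG.Holds M.str .nil w :=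
    (holds φG).congr fun M X w => by rw [hlist_nil_eq X]
  refine .and (isPermGraph (R := fun M X b c (w : Tup M.A (P ++ (T' ++ T'))) =>
      φG.Holds M.str .nil (append (fst w) (append b c)))
    (hG.comp (.append IsBlock.id.snd.snd.fst (.append IsBlock.id.fst IsBlock.id.snd.fst)))) ?_
  -- The relation put in place of R depends on the parameter `p`, which stays free in the resulting
  -- formula.
  refine (φm.definable_subst inr (fun M _ v => .cons (fun w => φG.Holds M.str .nil
    (append (fst v) w)) .nil) fun U Y => ?_).congr fun M X v => by rw [values_inr, append_fst_snd]
  cases Y with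
  | zero => exact hG.comp (.append IsBlock.id.snd.fst IsBlock.id.fst)
  | succ Y => cases Y

theorem Definable.adjoinRel {P T : List Srt} (φG : Formula S [] (P ++ (T ++ T))) :
    Definable (Δ := [T ++ T]) (Γ := .number :: P ++ (T ++ T)) fun (M : Model.{u} S) X w =>
      FPOrd.adjoinRel M.str φG (head X) (fst (l := Srt.number :: P) w)
        (fst (snd (l := Srt.number :: P) w))
        (snd (snd (l := Srt.number :: P) w)) := by
  have hG : Definable (Δ := [T ++ T]) fun (M : Model.{u} S) _ w => φG.Holds M.str .nil w :=
    ((holds φG).congr (Q' := fun M _ w => φG.Holds M.str .nil w)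
      fun M X w => by rw [hlist_nil_eq X]).weaken (T := T ++ T)
  have hp : IsBlock fun (M : Model.{u} S) (w : Tup M.A (.number :: P ++ (T ++ T))) =>
    fst (l := Srt.number :: P) w := IsBlock.fst (T := Srt.number :: P) .id
  have hbc : IsBlock fun (M : Model.{u} S) (w : Tup M.A (.number :: P ++ (T ++ T))) =>
    snd (l := Srt.number :: P) w := IsBlock.snd (T := Srt.number :: P) .id
  have hzero : Definable (Δ := [T ++ T]) fun (M : Model.{u} S) _
      (w : Tup M.A (.number :: P ++ (T ++ T))) =>
        ∀ x : Dom M.A .number, (head (fst (l := Srt.number :: P) w)).val ≤ x.val :=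
    all_one (Q := fun M _ x (w : Tup M.A (.number :: P ++ (T ++ T))) =>
      (head (fst (l := Srt.number :: P) w)).val ≤ x.val)
      (le (.head (hp.comp IsBlock.id.tail)) (.head .id))
  refine .or (.and hzero (hG.comp (.append hp.tail (.append hbc.fst hbc.snd))))
    (.and hzero.not ?_)
  exact (rvar (Idx.zero (a := T ++ T) (l := [])) (.append hbc.fst hbc.snd)).congr fun M X w => by
    cases X; rfl

/-! ### The empty domain -/

/-- The sentence stating that the domain is empty. -/
def emptyFormula (S : Signature.{w}) (Δ : List (List Srt)) (Γ : List Srt) : Formula S Δ Γ :=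
  .all .element (.neg (.eq .zero .zero))

theorem emptyFormula_holds {A : Type u} (𝔄 : Str S A) {Δ : List (List Srt)} {Γ : List Srt}
    (X : Env A Δ) (v : Tup A Γ) : (emptyFormula S Δ Γ).Holds 𝔄 X v ↔ IsEmpty A := by
  simp only [emptyFormula, Formula.Holds, not_true]
  exact ⟨fun h => ⟨fun a => h (.element a)⟩, fun h x => by cases x; exact h.elim ‹_›⟩

/-- On nonempty domains a definable query, on the empty domain everything. -/
theorem Definable.exists_formula {Δ : List (List Srt)} {Γ : List Srt}
    {Q : ∀ M : Model.{u} S, Env M.A Δ → Tup M.A Γ → Prop} (h : Definable Q) :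
    ∃ φ : Formula S Δ Γ, (∀ M X v, φ.Holds M.str X v ↔ Q M X v) ∧
      ∀ (A : Type u) [IsEmpty A] (𝔄 : Str S A) X v, φ.Holds 𝔄 X v := by
  obtain ⟨φ, hφ⟩ := h
  refine ⟨.neg (.and (.neg (emptyFormula S Δ Γ)) (.neg φ)), fun M X v => ?_, fun A _ 𝔄 X v => ?_⟩
  · simp only [Formula.Holds, emptyFormula_holds, hφ, not_isEmpty_iff]
    have := M.ne
    tauto
  · simp only [Formula.Holds, emptyFormula_holds, not_isEmpty_iff]
    rintro ⟨h, -⟩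
    exact not_nonempty_iff.2 ‹IsEmpty A› h

theorem subsingleton_dom {A : Type u} [IsEmpty A] : (a : Srt) → Subsingleton (Dom A a)
  | .element => ⟨fun x => by cases x; exact isEmptyElim ‹A›⟩
  | .number => ⟨fun x y => Dom.val_injective (by
      have hx := x.val_le
      have hy := y.val_le
      rw [Nat.card_of_isEmpty] at hx hy
      omega)⟩

theorem subsingleton_tup {A : Type u} [IsEmpty A] (T : List Srt) : Subsingleton (Tup A T) := by
  induction T with
  | nil => exact ⟨fun v v' => by rw [hlist_nil_eq v, hlist_nil_eq v']⟩
  | cons a T ih =>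
    have := subsingleton_dom (A := A) a
    exact (consEquiv (Dom A) a T).symm.subsingleton

end FPOrd

/-! ### The kernel of a definable morphism -/

open FPOrd in
theorem mainTheorem8 (S : FPOrd.Signature.{w}) (P T T' : List FPOrd.Srt)
    (φG : FPOrd.Formula S [] (P ++ (T ++ T)))
    (φm : FPOrd.Formula S [T ++ T] (T' ++ T')) :
    ∃ (φmem : FPOrd.Formula S [T ++ T] [])
      (φord : FPOrd.Formula S [] (FPOrd.numbers (2 * T.length))),
      ∀ (A : Type u) [Finite A] (𝔄 : FPOrd.Str S A)
        (m : FPOrd.generated 𝔄 φG →* Equiv.Perm (FPOrd.Tup A T')),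
        FPOrd.DefinesMorphism 𝔄 φm m →
          FPOrd.Encodes (fun μ => φord.Holds 𝔄 .nil μ) (Nat.card m.ker) ∧
          Nat.card m.ker = Nat.card (FPOrd.generated 𝔄 φG) / Nat.card m.range ∧
          ∀ τ : Equiv.Perm (FPOrd.Tup A T),
            φmem.Holds 𝔄 (.cons (FPOrd.graph τ) .nil) .nil ↔
              τ ∈ m.ker.map (FPOrd.generated 𝔄 φG).subtype := by
  let l := T.length + T'.length
  -- One arity for |G|, |im m| and |⟨G, τ⟩|, large enough for all three by
  -- `two_mul_card_subgroup_le`.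
  let k := 2 * l + 2 * (4 ^ l + 1)
  let a (M : Model.{u} S) : ℕ := Nat.card (generated M.str φG)
  let b (M : Model.{u} S) : ℕ := Nat.card (spanGroup (imageRel M.str φG φm))
  have ha : Definable (Δ := []) (Γ := numbers k) fun M _ v => (a M).testBit (index v) = true :=
    Definable.testBit_card_spanGroup (c := T'.length + (4 ^ l + 1)) (by omega)
      (Φ := fun M _ p s t => φG.Holds M.str .nil (append p (append s t)))
      ((Definable.holds φG).congr fun M X w => by
        rw [hlist_nil_eq X, append_fst_snd, append_fst_snd])
  have hb : Definable (Δ := []) (Γ := numbers k) fun M _ v => (b M).testBit (index v) = true :=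
    Definable.testBit_card_spanGroup (c := T.length + (4 ^ l + 1)) (by omega)
      (Φ := fun M _ => imageRel M.str φG φm) (.imageRel φG φm)
  have ha' (M : Model.{u} S) : 2 * a M ≤ 2 ^ maxIndex (Nat.card M.A) k :=
    two_mul_card_subgroup_le (by omega) _
  have hb' (M : Model.{u} S) : 2 * b M ≤ 2 ^ maxIndex (Nat.card M.A) k :=
    two_mul_card_subgroup_le (by omega) _
  have hpos (M : Model.{u} S) : 0 < a M := Nat.card_pos
  have hdiv : Definable (Δ := []) (Γ := numbers (2 * T.length)) fun M _ v =>
      (a M / b M).testBit (index v) = true :=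
    -- The division takes place at arity `k`; only the positions of arity `2 * T.length` are kept.
    Definable.testBit_of_add (j := 2 * T.length) (d := 2 * T'.length + 2 * (4 ^ l + 1)) (by
      have := Definable.testBit_div ha hb (fun M => by have := ha' M; have := hpos M; omega)
        (fun M => Nat.card_pos) hb'
      rwa [show k = 2 * T.length + (2 * T'.length + 2 * (4 ^ l + 1)) by omega] at this)
  have hadj : Definable (Δ := [T ++ T]) (Γ := numbers k) fun (M : Model.{u} S) X ξ =>
      (Nat.card (spanGroup (adjoinRel M.str φG (head X)))).testBit (index ξ) = true :=
    Definable.testBit_card_spanGroup (c := T'.length + (4 ^ l + 1)) (by omega)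
      (Φ := fun M X => adjoinRel M.str φG (head X)) (.adjoinRel φG)
  have hmem : Definable (Δ := [T ++ T]) (Γ := []) fun (M : Model.{u} S) X _ =>
      (∀ ξ : Tup M.A (numbers k),
        (Nat.card (spanGroup (adjoinRel M.str φG (head X)))).testBit (index ξ) = true ↔
          (a M).testBit (index ξ) = true) ∧
      ∀ w : Tup M.A (T' ++ T'), φm.Holds M.str X w → fst w = snd w := by
    refine .and (.all (T := numbers k) (Q := fun M X ξ _ =>
      ((Nat.card (spanGroup (adjoinRel M.str φG (head X)))).testBit (index ξ) = true ↔
        (a M).testBit (index ξ) = true)) (.iff (hadj.comp IsBlock.id.fst)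
        ((ha.weaken (T := T ++ T)).comp IsBlock.id.fst)))
      (.all (T := T' ++ T') (Q := fun M X w _ => φm.Holds M.str X w → fst w = snd w)
        (.imp ((Definable.holds φm).comp IsBlock.id.fst)
          (.eq IsBlock.id.fst.fst IsBlock.id.fst.snd)))
  obtain ⟨φord, hord, hord'⟩ := hdiv.exists_formula
  obtain ⟨φmem, hmem, hmem'⟩ := hmem.exists_formula
  refine ⟨φmem, φord, fun A _ 𝔄 m hm => ?_⟩
  have hcard := card_ker_eq_div m
  rcases isEmpty_or_nonempty A with hA | hA
  -- Over the empty domain `Sym(A^T)` is trivial, the kernel has order 1, and every position has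
  -- index 0. Both formulae must be true there, as `exists_formula` arranges.
  · have := subsingleton_tup (A := A) T
    have hindex : ∀ μ : Tup A (numbers (2 * T.length)), index μ = 0 := fun μ => by
      have : Subsingleton (Tup A (numbers (2 * T.length))) := subsingleton_tup _
      obtain ⟨ν, hν⟩ := exists_index (A := A) (k := 2 * T.length) (Nat.zero_le _)
      rw [← hν, Subsingleton.elim μ ν]
    refine ⟨fun μ => ?_, hcard, fun τ => ?_⟩
    · rw [hindex, Nat.card_unique]
      simpa using hord' A 𝔄 .nil μ
    · rw [Subsingleton.elim τ 1]
      exact iff_of_true (hmem' A 𝔄 _ _) (one_mem _)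
  · let M : Model.{u} S := ⟨A, ‹_›, hA, 𝔄⟩
    refine ⟨fun μ => ?_, hcard, fun τ => ?_⟩
    · rw [hcard, ← spanGroup_imageRel hm]
      exact hord M .nil μ
    · rw [show φmem.Holds 𝔄 (.cons (graph τ) .nil) .nil ↔ _ from hmem M _ _, head_cons]
      have hbit : (∀ ξ : Tup A (numbers k),
          (Nat.card (spanGroup (adjoinRel 𝔄 φG (graph τ)))).testBit (index ξ) = true ↔
            (a M).testBit (index ξ) = true) ↔ τ ∈ generated 𝔄 φG := by
        rw [spanGroup_adjoinRel]
        constructor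
        · intro h
          have heq : Nat.card (generated 𝔄 φG ⊔ Subgroup.zpowers τ : Subgroup _) = a M := by
            refine Nat.eq_of_testBit_eq fun i => ?_
            by_cases hi : i ≤ maxIndex (Nat.card A) k
            · obtain ⟨ξ, rfl⟩ := exists_index hi
              exact Bool.eq_iff_iff.2 (h ξ)
            -- Beyond the last position both orders have only zero bits, so agreement on positions
            -- is equality.
            · have hle := Nat.pow_le_pow_right two_pos (not_le.1 hi).le
              have h1 : 2 * Nat.card (generated 𝔄 φG ⊔ Subgroup.zpowers τ : Subgroup _) ≤
                  2 ^ maxIndex (Nat.card A) k := two_mul_card_subgroup_le (by omega) _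
              have h2 : 2 * a M ≤ 2 ^ maxIndex (Nat.card A) k := ha' M
              have h3 : 0 < 2 ^ maxIndex (Nat.card A) k := Nat.two_pow_pos _
              rw [Nat.testBit_lt_two_pow (by omega), Nat.testBit_lt_two_pow (by omega)]
          -- A finite group has no proper subgroup of its own order, so adjoining `τ` has added
          -- nothing.
          have := Subgroup.eq_of_le_of_card_ge (le_sup_left (a := generated 𝔄 φG)) heq.le
          rw [this]
          exact Subgroup.mem_sup_right (Subgroup.mem_zpowers τ)
        · intro h ξ
          rw [sup_eq_left.2 (Subgroup.zpowers_le.2 h)]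
      rw [hbit]
      have hone (h : τ ∈ generated 𝔄 φG) :
          (∀ w : Tup A (T' ++ T'), φm.Holds 𝔄 (.cons (graph τ) .nil) w → fst w = snd w) ↔
            m ⟨τ, h⟩ = 1 := by
        simp only [hm ⟨τ, h⟩]
        constructor
        · intro H
          refine Equiv.ext fun x => ?_
          have := H (append x (m ⟨τ, h⟩ x)) ⟨x, rfl⟩
          rw [fst_append, snd_append] at this
          exact this.symm
        · rintro H _ ⟨x, rfl⟩
          rw [fst_append, snd_append, H]
          rfl
      constructor
      · rintro ⟨h, H⟩
        exact ⟨⟨τ, h⟩, (hone h).1 H, rfl⟩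
      · rintro ⟨⟨σ, h⟩, H, rfl⟩
        exact ⟨h, (hone h).2 H⟩
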